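/- Let $n\ge 0$ and let a stabilizer circuit on $n$ qubits be an element of the group of unitary operators on $(\mathbb C^2)^{\otimes n}$ generated by the phase gates $P_i=\mathrm{diag}(1,i)$ on qubit $i$, the Hadamard gates $H_i$ on qubit $i$, and the CNOT gates $X_{ij}$ ($i\ne j$) with target $i$ and control $j$; in particular it can be any product $C=\prod_{k=1}^{\ell}M_k$ of such gates. Notation. For a one-qubit gate $U$ and $v\in\mathbb F_2^n$, $U_v$ applies $U$ to every qubit $i$ with $v_i=1$ and the identity to the other qubits; this gives $H_w$, $P_b$, and, for the Pauli gates, $\mathtt X_u$, $\mathtt Z_v$. We write $\mathbf H=\prod_{i=0}^{n-1}H_i$ for the Hadamard gate applied to all qubits. For $A\in GL_n(\mathbb F_2)$, $X_A$ is the operator $|b\rangle\mapsto|Ab\rangle$ (a product of CNOT gates). For a symmetric matrix $B$ over $\mathbb F_2$ with zero diagonal, $Z_B$ is the product of the controlled-$Z$ gates between the qubits $i$ and $j$ over all pairs $i<j$ with $B_{ij}=1$. With $p=\lfloor n/2\rfloor$ and $s\in\mathbb F_2^p$, the reduced matrix $B_s$ is the symmetric $n\times n$ matrix $$\begin{bmatrix}0_{p\times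 p}&\mathrm{diag}(s)\\ \mathrm{diag}(s)&0_{p\times p}\end{bmatrix},$$ bordered by one additional zero row and zero column at the end when $n$ is odd. Theorem (CZ-reduced normal form). Every stabilizer circuit $C$ on $n$ qubits can be written as $$C=H_w\,P_b\,X_{A_1}\,Z_{B_s}\,\mathbf H\,e^{i\phi}\,\mathtt X_u\,\mathtt Z_v\,X_{A_2}\,Z_{B_{s'}}\,X_{A_3}\,P_d$$ with $b,d,u,v,w\in\mathbb F_2^n$, $s,s'\in\mathbb F_2^{p}$, $A_1,A_2,A_3\in GL_n(\mathbb F_2)$ and $\phi\in\{k\frac{\pi}{4}: k\in\mathbb Z\}$. In particular, each of the two CZ layers $Z_{B_s}$ and $Z_{B_{s'}}$ contains at most $n/2$ CZ gates. -/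

import Mathlib

open scoped Matrix

noncomputable section

namespace StabilizerCircuit

/-- Operators on `n` qubits, as complex matrices in the computational basis `(|b⟩)`, `b ∈ 𝔽₂ⁿ`;
the entry `(a, b)` is `⟨a| U |b⟩`. -/
abbrev Op (n : ℕ) : Type := Matrix (Fin n → ZMod 2) (Fin n → ZMod 2) ℂ

/-! ### One-qubit gates -/

/-- The one-qubit operator with matrix `[p q; r t]` in the basis `(|0⟩, |1⟩)`. -/
def qubitOp (p q r t : ℂ) : Matrix (ZMod 2) (ZMod 2) ℂ :=
  Matrix.of fun a b => if a = 0 then (if b = 0 then p else q) else (if b = 0 then r else t)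

/-- The Pauli gate `X` (the `NOT` gate). -/
def pauliX : Matrix (ZMod 2) (ZMod 2) ℂ := qubitOp 0 1 1 0

/-- The Pauli gate `Z`. -/
def pauliZ : Matrix (ZMod 2) (ZMod 2) ℂ := qubitOp 1 0 0 (-1)

/-- The phase gate `P`. -/
def phase : Matrix (ZMod 2) (ZMod 2) ℂ := qubitOp 1 0 0 Complex.I

/-- The Hadamard gate `H`. -/
def hadamard : Matrix (ZMod 2) (ZMod 2) ℂ := ((1 / √2 : ℝ) : ℂ) • qubitOp 1 1 1 (-1)

/-- The tensor product `M 0 ⊗ M 1 ⊗ ⋯ ⊗ M (n - 1)` of one-qubit operators. -/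
def tensor {n : ℕ} (M : Fin n → Matrix (ZMod 2) (ZMod 2) ℂ) : Op n :=
  Matrix.of fun a b => ∏ i, M i (a i) (b i)

/-- The operator `U_v` that applies the one-qubit gate `U` to each qubit `i` with `v i = 1` and
the identity to the other qubits. -/
def onQubits {n : ℕ} (U : Matrix (ZMod 2) (ZMod 2) ℂ) (v : Fin n → ZMod 2) : Op n :=
  tensor fun i => if v i = 1 then U else 1

/-- The gate `U` applied to qubit `i` alone, that is `U_i = U_{e_i}`. -/
def onQubit {n : ℕ} (U : Matrix (ZMod 2) (ZMod 2) ℂ) (i : Fin n) : Op n :=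
  onQubits U (Pi.single i 1)

/-! ### Two-qubit gates and layers of two-qubit gates -/

/-- The gate `X_{ij}`: the `CNOT` gate with target `i` and control `j`,
`|b⟩ ↦ |b₀ ⋯ b_i ⊕ b_j ⋯ b_{n-1}⟩`. -/
def cnotGate {n : ℕ} (i j : Fin n) : Op n :=
  Matrix.of fun a b => if a = Function.update b i (b i + b j) then 1 else 0

/-- The operator `X_A`, `|b⟩ ↦ |A b⟩`, for `A ∈ GL_n(𝔽₂)`; it is a product of `CNOT` gates
(`cnotLayer_mem_closure`). -/
def cnotLayer {n : ℕ} (A : GL (Fin n) (ZMod 2)) : Op n :=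
  Matrix.of fun a b => if a = A.val *ᵥ b then 1 else 0

/-- The gate `Z_{ij}`: the `CZ` gate between qubits `i` and `j`, `|b⟩ ↦ (-1)^{b_i b_j} |b⟩`. -/
def czGate {n : ℕ} (i j : Fin n) : Op n :=
  Matrix.diagonal fun b => (-1) ^ (b i * b j).val

/-- The symmetric `n × n` matrices over `𝔽₂` with zero diagonal. -/
def SymmZeroDiag (n : ℕ) : Type :=
  {B : Matrix (Fin n) (Fin n) (ZMod 2) // B.IsSymm ∧ ∀ i, B i i = 0}

/-- The pairs `i < j` with `B_{ij} = 1`, that is, the `CZ` gates of the circuit `Z_B`. -/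
def czPairs {n : ℕ} (B : SymmZeroDiag n) : Finset (Fin n × Fin n) :=
  Finset.univ.filter fun p => p.1 < p.2 ∧ B.val p.1 p.2 = 1

theorem czGate_commute {n : ℕ} (i j k l : Fin n) : Commute (czGate i j) (czGate k l) := by
  simp only [czGate, Commute, SemiconjBy, Matrix.diagonal_mul_diagonal]
  congr 1
  funext b
  exact mul_comm _ _

/-- The circuit `Z_B`: the product of the (pairwise commuting) gates `Z_{ij}` over the pairs
`i < j` with `B_{ij} = 1`. -/
def czLayer {n : ℕ} (B : SymmZeroDiag n) : Op n :=
  (czPairs B).noncommProd (fun p => czGate p.1 p.2) fun _ _ _ _ _ => czGate_commute _ _ _ _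

/-- The entries of the reduced matrix `B_s`, with `p = ⌊n/2⌋`: the blocks `(0, 1)` and `(1, 0)` of
size `p × p` are `diag(s)`, and every other entry (in particular the last row and the last column
for odd `n`) is `0`. -/
def reducedEntries {n : ℕ} (s : Fin (n / 2) → ZMod 2) : Matrix (Fin n) (Fin n) (ZMod 2) :=
  Matrix.of fun i j =>
    if h : i.val < n / 2 ∧ j.val = i.val + n / 2 then s ⟨i.val, h.1⟩
    else if h : j.val < n / 2 ∧ i.val = j.val + n / 2 then s ⟨j.val, h.1⟩
    else 0

/-- The reduced matrix `B_s`. -/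
def reduced {n : ℕ} (s : Fin (n / 2) → ZMod 2) : SymmZeroDiag n :=
  ⟨reducedEntries s, by
    constructor
    · ext i j
      simp only [reducedEntries, Matrix.transpose_apply, Matrix.of_apply]
      split_ifs <;> first | rfl | (exfalso; omega)
    · intro i
      simp only [reducedEntries, Matrix.of_apply]
      split_ifs <;> first | rfl | (exfalso; omega)⟩

/-! ### Stabilizer circuits -/

/-- The gates `P_i`, `H_i` and `X_{ij}` (`i ≠ j`) on `n` qubits. -/
def cliffordGates (n : ℕ) : Set (Op n) :=
  {U | (∃ i, U = onQubit phase i) ∨ (∃ i, U = onQubit hadamard i) ∨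
    ∃ i j, i ≠ j ∧ U = cnotGate i j}

/-- The group of stabilizer circuits on `n` qubits: the subgroup of the unitary group generated by
the gates `P_i`, `H_i` and `X_{ij}` (all of them are unitary, `cliffordGates_subset`). -/
def stabilizerGroup (n : ℕ) : Subgroup (Matrix.unitaryGroup (Fin n → ZMod 2) ℂ) :=
  Subgroup.closure {U | U.val ∈ cliffordGates n}

/-! ### Sanity facts: the gates are unitary, and `X_A` is a `CNOT` circuit -/

theorem tensor_mul {n : ℕ} (M N : Fin n → Matrix (ZMod 2) (ZMod 2) ℂ) :
    tensor M * tensor N = tensor fun i => M i * N i := by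
  ext a b
  simp only [tensor, Matrix.mul_apply, Matrix.of_apply, ← Finset.prod_mul_distrib]
  rw [Finset.prod_univ_sum, Fintype.piFinset_univ]

theorem tensor_one {n : ℕ} : tensor (fun _ : Fin n => 1) = 1 := by
  ext a b
  simp only [tensor, Matrix.of_apply, Matrix.one_apply, Finset.prod_ite_zero, funext_iff]
  simp

theorem tensor_conjTranspose {n : ℕ} (M : Fin n → Matrix (ZMod 2) (ZMod 2) ℂ) :
    (tensor M)ᴴ = tensor fun i => (M i)ᴴ := by
  ext a b
  simp [tensor, Matrix.conjTranspose_apply]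

theorem onQubits_mem_unitaryGroup {n : ℕ} {U : Matrix (ZMod 2) (ZMod 2) ℂ} (hU : U * Uᴴ = 1)
    (v : Fin n → ZMod 2) : onQubits U v ∈ Matrix.unitaryGroup (Fin n → ZMod 2) ℂ := by
  rw [Matrix.mem_unitaryGroup_iff, Matrix.star_eq_conjTranspose, onQubits, tensor_conjTranspose,
    tensor_mul, ← tensor_one]
  congr 1
  funext i
  split_ifs <;> simp [hU]

theorem qubitOp_mul (p q r t p' q' r' t' : ℂ) : qubitOp p q r t * qubitOp p' q' r' t' =
    qubitOp (p * p' + q * r') (p * q' + q * t') (r * p' + t * r') (r * q' + t * t') := by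
  ext a b
  rw [Matrix.mul_apply, show (Finset.univ : Finset (ZMod 2)) = {0, 1} from rfl,
    Finset.sum_pair (by decide)]
  simp only [qubitOp, Matrix.of_apply, if_true, one_ne_zero, if_false]
  split_ifs <;> rfl

theorem qubitOp_conjTranspose (p q r t : ℂ) :
    (qubitOp p q r t)ᴴ = qubitOp (star p) (star r) (star q) (star t) := by
  ext a b
  simp only [qubitOp, Matrix.conjTranspose_apply, Matrix.of_apply]
  split_ifs <;> rfl

theorem qubitOp_one : qubitOp 1 0 0 1 = 1 := by
  have two : ∀ x : ZMod 2, x = 0 ∨ x = 1 := by decide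
  ext a b
  rcases two a with rfl | rfl <;> rcases two b with rfl | rfl <;> simp [qubitOp]

theorem phase_mul_conjTranspose : phase * phaseᴴ = 1 := by
  rw [phase, qubitOp_conjTranspose, qubitOp_mul, ← qubitOp_one]
  simp

theorem hadamard_mul_conjTranspose : hadamard * hadamardᴴ = 1 := by
  have h : (((1 / √2 : ℝ) : ℂ)) * ((1 / √2 : ℝ) : ℂ) = 1 / 2 := by
    rw [← Complex.ofReal_mul, div_mul_div_comm, Real.mul_self_sqrt (by norm_num)]; norm_num
  rw [hadamard, Matrix.conjTranspose_smul, Matrix.smul_mul, Matrix.mul_smul, smul_smul,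
    RCLike.star_def, Complex.conj_ofReal, h, qubitOp_conjTranspose, qubitOp_mul, ← qubitOp_one]
  ext a b
  simp only [qubitOp, Matrix.smul_apply, Matrix.of_apply, smul_eq_mul]
  split_ifs <;> simp <;> norm_num

theorem cnotLayer_mul {n : ℕ} (A B : GL (Fin n) (ZMod 2)) :
    cnotLayer A * cnotLayer B = cnotLayer (A * B) := by
  ext a b
  simp [cnotLayer, Matrix.mul_apply, Matrix.mulVec_mulVec]

theorem cnotGate_mul_self {n : ℕ} {i j : Fin n} (h : i ≠ j) :
    cnotGate i j * cnotGate i j = 1 := by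
  have key : ∀ b : Fin n → ZMod 2, Function.update (Function.update b i (b i + b j)) i
      (Function.update b i (b i + b j) i + Function.update b i (b i + b j) j) = b := by
    intro b
    have : b i + b j + b j = b i := by rw [add_assoc, CharTwo.add_self_eq_zero, add_zero]
    rw [Function.update_idem, Function.update_self, Function.update_of_ne h.symm, this,
      Function.update_eq_self]
  ext a b
  simp only [cnotGate, Matrix.mul_apply, Matrix.of_apply, mul_ite, mul_one, mul_zero,
    Finset.sum_ite_eq', Finset.mem_univ, if_true, Matrix.one_apply]
  rw [key]

theorem cnotGate_conjTranspose {n : ℕ} {i j : Fin n} (h : i ≠ j) :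
    (cnotGate i j)ᴴ = cnotGate i j := by
  have key : ∀ a b : Fin n → ZMod 2, a = Function.update b i (b i + b j) →
      b = Function.update a i (a i + a j) := by
    rintro a b rfl
    have : b i + b j + b j = b i := by rw [add_assoc, CharTwo.add_self_eq_zero, add_zero]
    rw [Function.update_idem, Function.update_self, Function.update_of_ne h.symm, this,
      Function.update_eq_self]
  ext a b
  simp only [cnotGate, Matrix.conjTranspose_apply, Matrix.of_apply]
  rw [if_congr ⟨key b a, key a b⟩ rfl rfl]
  split_ifs <;> simp

theorem cliffordGates_subset (n : ℕ) :
    cliffordGates n ⊆ (Matrix.unitaryGroup (Fin n → ZMod 2) ℂ : Set (Op n)) := by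
  rintro U (⟨i, rfl⟩ | ⟨i, rfl⟩ | ⟨i, j, h, rfl⟩)
  · exact onQubits_mem_unitaryGroup phase_mul_conjTranspose _
  · exact onQubits_mem_unitaryGroup hadamard_mul_conjTranspose _
  · rw [SetLike.mem_coe, Matrix.mem_unitaryGroup_iff, Matrix.star_eq_conjTranspose,
      cnotGate_conjTranspose h, cnotGate_mul_self h]

theorem cnotLayer_mem_closure {n : ℕ} (A : GL (Fin n) (ZMod 2)) :
    cnotLayer A ∈ Submonoid.closure {U : Op n | ∃ i j, i ≠ j ∧ U = cnotGate i j} := by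
  let F : Matrix (Fin n) (Fin n) (ZMod 2) → Op n := fun M =>
    Matrix.of fun a b => if a = M *ᵥ b then 1 else 0
  have Fmul : ∀ M N, F (M * N) = F M * F N := by
    intro M N
    ext a b
    simp [F, Matrix.mul_apply, Matrix.mulVec_mulVec]
  have F1 : F 1 = 1 := by
    ext a b
    simp [F, Matrix.one_apply]
  have two : ∀ x : ZMod 2, x = 0 ∨ x = 1 := by decide
  change F A.val ∈ _
  refine Matrix.diagonal_transvection_induction_of_det_ne_zero
    (fun M => F M ∈ Submonoid.closure {U : Op n | ∃ i j, i ≠ j ∧ U = cnotGate i j}) A.val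
    ((Matrix.isUnit_iff_isUnit_det _).1 A.isUnit).ne_zero ?_ ?_ ?_
  · intro D hD
    have : D = fun _ => 1 := by
      funext i
      rw [Matrix.det_diagonal, Finset.prod_ne_zero_iff] at hD
      exact (two (D i)).resolve_left (hD i (Finset.mem_univ i))
    rw [this, Matrix.diagonal_one, F1]
    exact one_mem _
  · rintro ⟨i, j, h, c⟩
    rcases two c with rfl | rfl
    · simp only [Matrix.TransvectionStruct.toMatrix, Matrix.transvection_zero, F1]
      exact one_mem _
    · apply Submonoid.subset_closure
      refine ⟨i, j, h, ?_⟩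
      ext a b
      have : Matrix.transvection i j (1 : ZMod 2) *ᵥ b = Function.update b i (b i + b j) := by
        ext k
        rw [Matrix.transvection, Matrix.add_mulVec, Matrix.one_mulVec, Pi.add_apply]
        by_cases hk : k = i
        · subst hk
          simp [Matrix.single_mulVec]
        · simp [Matrix.single_mulVec, hk]
      simp only [F, cnotGate, Matrix.TransvectionStruct.toMatrix, Matrix.of_apply, this]
  · intro M N _ _ hM hN
    rw [Fmul]
    exact mul_mem hM hN

end StabilizerCircuit

end

open StabilizerCircuit

/-!
A stabilizer circuit `C` permutes the Pauli operators `X_x Z_z` by conjugation, up to scalars, and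
the permutation is a symplectic map `f` of the phase space `𝔽₂ⁿ × 𝔽₂ⁿ` of the labels `(x, z)`
(`exists_isClifford_of_mem_stabilizerGroup`). Each layer of the normal form acts by an explicit
symplectic map, so the theorem splits into a factorization of `f` and a determination of what is
left when two circuits have the same `f`.

The factorization (`IsSymp.exists_normalForm`) rests on a Bruhat-type decomposition
(`IsSymp.exists_bruhat`): after a suitable Hadamard layer, the image of the Lagrangian subspace
`{(0, z)}` is transverse to `{(0, z)}` (`IsSymp.exists_hAct_transverse`), and then `f` is a product
of a shear `z ↦ z + S x`, the exchange of `x` and `z`, a linear change of coordinates and a second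
shear. A symmetric `S` is the sum of its diagonal, which is a phase layer, and of an alternating
matrix, which is congruent to a reduced matrix `B_s` (`exists_congruent_reduced`); the congruence is
absorbed into the `CNOT` layers.

If `L` and `R` denote the layers of the normal form to the left and to the right of the Pauli
operator, then `L⁻¹ C R⁻¹` commutes with all Pauli operators up to scalars, so that it is a multiple
`c` of a Pauli operator (`Acts.eq_smul_pauli`). Finally `c` is an element of `ℤ[ζ₈, 1/2]` of
absolute value `1`, because all gates have entries in this ring; a descent modulo 4 shows that it is
a power of `ζ₈ = e^{iπ/4}` (`exists_eq_zeta_pow`).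
-/

open scoped Matrix

noncomputable section

namespace StabilizerCircuit

/-! ### Symplectic maps of the phase space -/

/-- The phase space `𝔽₂ⁿ × 𝔽₂ⁿ`: the point `(x, z)` labels the Pauli operator `X_x Z_z`. -/
abbrev PhaseSpace (n : ℕ) : Type := (Fin n → ZMod 2) × (Fin n → ZMod 2)

/-- The standard symplectic form on the phase space. -/
def symp {n : ℕ} (p q : PhaseSpace n) : ZMod 2 := p.1 ⬝ᵥ q.2 + p.2 ⬝ᵥ q.1

/-- A map of the phase space preserving the symplectic form. Additivity is not part of the
definition, since it follows (`IsSymp.map_add`). -/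
def IsSymp {n : ℕ} (f : PhaseSpace n → PhaseSpace n) : Prop :=
  ∀ p q, symp (f p) (f q) = symp p q

/-- The action of the Hadamard layer `H_w`: the coordinates `x i` and `z i` are exchanged for those
`i` with `w i = 1`. -/
def hAct {n : ℕ} (w : Fin n → ZMod 2) (p : PhaseSpace n) : PhaseSpace n :=
  (p.1 + w * (p.1 + p.2), p.2 + w * (p.1 + p.2))

/-- The map `(x, z) ↦ (x, z + S x)`, the action of the phase layer `P_b` for `S = diag(b)` and of
the layer `Z_S` for `S` with zero diagonal. -/
def shear {n : ℕ} (S : Matrix (Fin n) (Fin n) (ZMod 2)) (p : PhaseSpace n) : PhaseSpace n :=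
  (p.1, p.2 + S *ᵥ p.1)

/-- The action `(x, z) ↦ (A x, A⁻ᵀ z)` of the layer `X_A`. -/
def xAct {n : ℕ} (A : GL (Fin n) (ZMod 2)) (p : PhaseSpace n) : PhaseSpace n :=
  (A.val *ᵥ p.1, (A⁻¹).valᵀ *ᵥ p.2)

theorem zmod_two_eq_zero_or_one (t : ZMod 2) : t = 0 ∨ t = 1 := by
  revert t; decide

theorem symp_add_left {n : ℕ} (p q r : PhaseSpace n) : symp (p + q) r = symp p r + symp q r := by
  simp only [symp, Prod.fst_add, Prod.snd_add, add_dotProduct]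
  ring

theorem eq_of_symp_eq {n : ℕ} {p q : PhaseSpace n} (h : ∀ r, symp p r = symp q r) : p = q := by
  refine Prod.ext (dotProduct_eq _ _ fun u => ?_) (dotProduct_eq _ _ fun u => ?_)
  · simpa [symp] using h (0, u)
  · simpa [symp] using h (u, 0)

theorem IsSymp.comp {n : ℕ} {f g : PhaseSpace n → PhaseSpace n} (hf : IsSymp f) (hg : IsSymp g) :
    IsSymp (f ∘ g) := fun p q => (hf _ _).trans (hg p q)

theorem IsSymp.injective {n : ℕ} {f : PhaseSpace n → PhaseSpace n} (hf : IsSymp f) :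
    Function.Injective f := fun p q h => eq_of_symp_eq fun r => by rw [← hf p r, ← hf q r, h]

theorem IsSymp.exists_rightInverse {n : ℕ} {f : PhaseSpace n → PhaseSpace n} (hf : IsSymp f) :
    ∃ g, IsSymp g ∧ ∀ p, f (g p) = p := by
  obtain ⟨g, hg⟩ := (Finite.injective_iff_surjective.1 hf.injective).hasRightInverse
  exact ⟨g, fun p q => by rw [← hf, hg, hg], hg⟩

theorem IsSymp.map_add {n : ℕ} {f : PhaseSpace n → PhaseSpace n} (hf : IsSymp f)
    (p q : PhaseSpace n) : f (p + q) = f p + f q := by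
  obtain ⟨g, -, hg⟩ := hf.exists_rightInverse
  refine eq_of_symp_eq fun r => ?_
  rw [← hg r, symp_add_left, hf, hf, hf, symp_add_left]

theorem isSymp_hAct {n : ℕ} (w : Fin n → ZMod 2) : IsSymp (hAct w) := by
  intro p q
  simp only [symp, hAct, dotProduct, ← Finset.sum_add_distrib]
  refine Finset.sum_congr rfl fun i _ => ?_
  simp only [Pi.add_apply, Pi.mul_apply]
  generalize w i = a; generalize p.1 i = b; generalize p.2 i = c
  generalize q.1 i = d; generalize q.2 i = e
  revert a b c d e; decide

theorem hAct_hAct {n : ℕ} (w w' : Fin n → ZMod 2) (p : PhaseSpace n) :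
    hAct w (hAct w' p) = hAct (w + w') p := by
  have key : ∀ a b c d : ZMod 2, c + b * (c + d) + a * (c + b * (c + d) + (d + b * (c + d))) =
      c + (a + b) * (c + d) := by decide
  refine Prod.ext (funext fun i => key _ _ _ _) (funext fun i => ?_)
  simp only [hAct, Pi.add_apply, Pi.mul_apply]
  rw [add_comm (p.1 i), add_comm (p.1 i + _)]
  exact key _ _ _ _

theorem hAct_one {n : ℕ} (p : PhaseSpace n) : hAct 1 p = p.swap := by
  have key : ∀ c d : ZMod 2, c + 1 * (c + d) = d := by decide
  refine Prod.ext (funext fun i => key _ _) (funext fun i => ?_)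
  simp only [hAct, Pi.add_apply, Pi.mul_apply, add_comm (p.1 i)]
  exact key _ _

theorem hAct_self {n : ℕ} (w : Fin n → ZMod 2) (p : PhaseSpace n) : hAct w (hAct w p) = p := by
  rw [hAct_hAct, ZModModule.add_self]
  simp [hAct]

theorem mulVec_dotProduct_transpose {n : ℕ} (S : Matrix (Fin n) (Fin n) (ZMod 2))
    (x y : Fin n → ZMod 2) : (S *ᵥ x) ⬝ᵥ y = x ⬝ᵥ (Sᵀ *ᵥ y) := by
  rw [Matrix.mulVec_transpose, dotProduct_comm, Matrix.dotProduct_mulVec, dotProduct_comm]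

theorem isSymp_shear {n : ℕ} {S : Matrix (Fin n) (Fin n) (ZMod 2)} (hS : S.IsSymm) :
    IsSymp (shear S) := by
  intro p q
  simp only [symp, shear, dotProduct_add, add_dotProduct, mulVec_dotProduct_transpose, hS.eq]
  linear_combination CharTwo.add_self_eq_zero (p.1 ⬝ᵥ S *ᵥ q.1)

theorem shear_add {n : ℕ} (S T : Matrix (Fin n) (Fin n) (ZMod 2)) (p : PhaseSpace n) :
    shear (S + T) p = shear S (shear T p) := by
  simp only [shear, Matrix.add_mulVec]
  rw [add_assoc, add_comm (T *ᵥ p.1)]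

theorem shear_self {n : ℕ} (S : Matrix (Fin n) (Fin n) (ZMod 2)) (p : PhaseSpace n) :
    shear S (shear S p) = p := by
  rw [← shear_add, ZModModule.add_self]
  simp [shear]

theorem isSymp_xAct {n : ℕ} (A : GL (Fin n) (ZMod 2)) : IsSymp (xAct A) := by
  intro p q
  simp only [symp, xAct]
  rw [mulVec_dotProduct_transpose, mulVec_dotProduct_transpose, Matrix.transpose_transpose,
    Matrix.mulVec_mulVec, Matrix.mulVec_mulVec, ← Matrix.transpose_mul, ← Units.val_mul,
    inv_mul_cancel]
  simp

theorem xAct_mul {n : ℕ} (A B : GL (Fin n) (ZMod 2)) (p : PhaseSpace n) :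
    xAct (A * B) p = xAct A (xAct B p) := by
  simp only [xAct, Units.val_mul, mul_inv_rev, Matrix.transpose_mul, Matrix.mulVec_mulVec]

/-- The inverse transpose of an invertible matrix. -/
def invTranspose {n : ℕ} (A : GL (Fin n) (ZMod 2)) : GL (Fin n) (ZMod 2) where
  val := (A⁻¹).valᵀ
  inv := A.valᵀ
  val_inv := by rw [← Matrix.transpose_mul, ← Units.val_mul, mul_inv_cancel]; simp
  inv_val := by rw [← Matrix.transpose_mul, ← Units.val_mul, inv_mul_cancel]; simp

theorem xAct_hAct_one {n : ℕ} (A : GL (Fin n) (ZMod 2)) (p : PhaseSpace n) :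
    xAct A (hAct 1 p) = hAct 1 (xAct (invTranspose A) p) := by
  have : ((invTranspose A)⁻¹).val = A.valᵀ := rfl
  simp only [hAct_one, xAct, this, Matrix.transpose_transpose]
  rfl

/-- A congruence `Gᵀ S G` of the symmetric matrix amounts to a conjugation by the action of
`X_G`. -/
theorem shear_congruence {n : ℕ} (G : GL (Fin n) (ZMod 2)) (S : Matrix (Fin n) (Fin n) (ZMod 2))
    (p : PhaseSpace n) : shear (G.valᵀ * S * G.val) p = xAct G⁻¹ (shear S (xAct G p)) := by
  have h : G.valᵀ * (G⁻¹).valᵀ = 1 := by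
    rw [← Matrix.transpose_mul, ← Units.val_mul, inv_mul_cancel]; simp
  have h' : (G⁻¹).val * G.val = 1 := by rw [← Units.val_mul, inv_mul_cancel]; rfl
  simp only [shear, xAct, inv_inv, Matrix.mulVec_add, Matrix.mulVec_mulVec, h, h',
    Matrix.one_mulVec, Matrix.mul_assoc]

/-! ### Alternating matrices over `𝔽₂` -/

theorem dotProduct_mulVec_self_eq_zero {n : ℕ} {B : Matrix (Fin n) (Fin n) (ZMod 2)}
    (hB : B.IsSymm) (hd : ∀ i, B i i = 0) (x : Fin n → ZMod 2) : x ⬝ᵥ (B *ᵥ x) = 0 := by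
  have : x ⬝ᵥ (B *ᵥ x) = ∑ p : Fin n × Fin n, x p.1 * B p.1 p.2 * x p.2 := by
    simp only [dotProduct, Matrix.mulVec, Finset.mul_sum, Fintype.sum_prod_type, mul_assoc]
  rw [this]
  refine Finset.sum_involution (fun p _ => p.swap) ?_ ?_ (by simp) (by simp)
  · intro p _
    rw [Prod.fst_swap, Prod.snd_swap, ← hB.apply p.1 p.2]
    linear_combination CharTwo.add_self_eq_zero (x p.1 * B p.2 p.1 * x p.2)
  · rintro ⟨i, j⟩ _ hp h
    obtain rfl : j = i := congrArg Prod.fst h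
    exact hp (by simp [hd])

/-- An alternating matrix is a sum of hyperbolic pieces `α βᵀ + β αᵀ` whose vectors are jointly
linearly independent. The last clause, that all these vectors annihilate the radical of `B`, makes
the induction go through: splitting off one hyperbolic plane enlarges the radical. -/
theorem exists_hyperbolic_decomposition {n : ℕ} (B : Matrix (Fin n) (Fin n) (ZMod 2))
    (hB : B.IsSymm) (hd : ∀ i, B i i = 0) :
    ∃ (k : ℕ) (α β : Fin k → Fin n → ZMod 2), LinearIndependent (ZMod 2) (Sum.elim α β) ∧
      B = ∑ i, (Matrix.vecMulVec (α i) (β i) + Matrix.vecMulVec (β i) (α i)) ∧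
      ∀ x, B *ᵥ x = 0 → ∀ i, α i ⬝ᵥ x = 0 ∧ β i ⬝ᵥ x = 0 := by
  classical
  induction hm : (Finset.univ.filter fun x => B *ᵥ x ≠ 0).card using Nat.strong_induction_on
    generalizing B with
  | _ m ih =>
  by_cases h0 : ∀ x, B *ᵥ x = 0
  · refine ⟨0, Fin.elim0, Fin.elim0, linearIndependent_empty_type, ?_, fun _ _ i => i.elim0⟩
    have : B = 0 := Matrix.ext_of_mulVec_single fun i => by rw [h0, Matrix.zero_mulVec]
    simpa using this
  push Not at h0
  obtain ⟨e, he⟩ := h0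
  obtain ⟨i₀, hi₀⟩ := Function.ne_iff.1 he
  obtain ⟨f, hf⟩ : ∃ f, f ⬝ᵥ (B *ᵥ e) = 1 :=
    ⟨Pi.single i₀ 1, by simpa using (zmod_two_eq_zero_or_one _).resolve_left hi₀⟩
  have hsymm : ∀ x y, (B *ᵥ x) ⬝ᵥ y = x ⬝ᵥ (B *ᵥ y) := fun x y => by
    rw [mulVec_dotProduct_transpose, hB.eq]
  have haf : (B *ᵥ f) ⬝ᵥ f = 0 := by rw [hsymm, dotProduct_mulVec_self_eq_zero hB hd]
  have hbe : (B *ᵥ e) ⬝ᵥ e = 0 := by rw [hsymm, dotProduct_mulVec_self_eq_zero hB hd]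
  have hae : (B *ᵥ f) ⬝ᵥ e = 1 := by rw [hsymm, hf]
  have hbf : (B *ᵥ e) ⬝ᵥ f = 1 := by rw [dotProduct_comm, hf]
  have hrad : ∀ x, B *ᵥ x = 0 → (B *ᵥ f) ⬝ᵥ x = 0 ∧ (B *ᵥ e) ⬝ᵥ x = 0 := fun x hx => by
    simp [hsymm, hx]
  set a := B *ᵥ f with ha
  set b := B *ᵥ e with hb
  let B' := B + (Matrix.vecMulVec a b + Matrix.vecMulVec b a)
  have hB' : ∀ x, B' *ᵥ x = B *ᵥ x + ((b ⬝ᵥ x) • a + (a ⬝ᵥ x) • b) := fun x => by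
    simp [B', Matrix.add_mulVec, Matrix.vecMulVec_mulVec]
  have hB'e : B' *ᵥ e = 0 := by
    rw [hB', hbe, hae, ← hb, zero_smul, one_smul, zero_add, ZModModule.add_self]
  have hB'f : B' *ᵥ f = 0 := by
    rw [hB', hbf, haf, ← ha, zero_smul, one_smul, add_zero, ZModModule.add_self]
  have hrad' : ∀ x, B *ᵥ x = 0 → B' *ᵥ x = 0 := fun x hx => by
    rw [hB', hx, (hrad x hx).1, (hrad x hx).2]; simp
  obtain ⟨k, α, β, hli, hsum, hker⟩ := ih _ (by
      rw [← hm]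
      refine Finset.card_lt_card (Finset.ssubset_iff_of_subset ?_ |>.2 ⟨e, ?_, ?_⟩)
      · intro x hx
        simp only [Finset.mem_filter, Finset.mem_univ, true_and] at hx ⊢
        exact fun h => hx (hrad' x h)
      · simpa using he
      · simpa using hB'e) B'
    (by
      refine hB.add ?_
      rw [Matrix.IsSymm, Matrix.transpose_add, Matrix.transpose_vecMulVec,
        Matrix.transpose_vecMulVec, add_comm])
    (fun i => by
      simp only [B', Matrix.add_apply, hd, Matrix.vecMulVec_apply, zero_add]
      rw [mul_comm (b i), CharTwo.add_self_eq_zero]) rfl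
  refine ⟨k + 1, Fin.cons a α, Fin.cons b β, ?_, ?_, ?_⟩
  · rw [Fintype.linearIndependent_iff] at hli ⊢
    intro g hg
    simp only [Fintype.sum_sum_type, Sum.elim_inl, Sum.elim_inr, Fin.sum_univ_succ, Fin.cons_zero,
      Fin.cons_succ] at hg
    have h1 : g (Sum.inl 0) = 0 := by
      have := congrArg (· ⬝ᵥ e) hg
      simpa [add_dotProduct, smul_dotProduct, sum_dotProduct, hae, hbe, hker e hB'e] using this
    have h2 : g (Sum.inr 0) = 0 := by
      have := congrArg (· ⬝ᵥ f) hg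
      simpa [add_dotProduct, smul_dotProduct, sum_dotProduct, haf, hbf, hker f hB'f] using this
    have h3 := hli (fun i => g (i.map Fin.succ Fin.succ)) (by
      simpa [Fintype.sum_sum_type, h1, h2] using hg)
    rintro (i | i) <;> refine Fin.cases ?_ (fun i => ?_) i
    · exact h1
    · exact h3 (Sum.inl i)
    · exact h2
    · exact h3 (Sum.inr i)
  · rw [Fin.sum_univ_succ]
    simp only [Fin.cons_zero, Fin.cons_succ]
    rw [← hsum, add_comm, add_assoc, ZModModule.add_self, add_zero]
  · intro x hx i
    refine Fin.cases ?_ (fun i => ?_) i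
    · simpa using hrad x hx
    · simpa using hker x (hrad' x hx) i

/-- A linearly independent family of vectors in `K^m`, placed at prescribed positions, can be
completed to the rows of an invertible matrix. -/
theorem exists_gl_rows_extending {K ι : Type*} [Field K] [Fintype ι] {m : ℕ} {v : ι → Fin m → K}
    (hv : LinearIndependent K v) {j : ι → Fin m} (hj : Function.Injective j) :
    ∃ G : GL (Fin m) K, ∀ i, G.val (j i) = v i := by
  classical
  let bs := Module.Basis.sumExtend hv
  have : Finite (ι ⊕ Module.Basis.sumExtendIndex hv) := Module.Finite.finite_basis bs
  have : Finite (Module.Basis.sumExtendIndex hv) := 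
    Finite.of_injective (Sum.inr : _ → ι ⊕ _) Sum.inr_injective
  have := Fintype.ofFinite (Module.Basis.sumExtendIndex hv)
  have hcard : Fintype.card ι + Fintype.card (Module.Basis.sumExtendIndex hv) = m := by
    rw [← Fintype.card_sum, ← Module.finrank_eq_card_basis bs]
    simp
  have hcard' : Fintype.card (Module.Basis.sumExtendIndex hv) =
      Fintype.card ((Set.range j)ᶜ : Set (Fin m)) := by
    rw [Fintype.card_compl_set, Set.card_range_of_injective hj, Fintype.card_fin]
    omega
  let e : ι ⊕ Module.Basis.sumExtendIndex hv ≃ Fin m :=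
    ((Equiv.ofInjective j hj).sumCongr (Fintype.equivOfCardEq hcard')).trans
      (Equiv.Set.sumCompl (Set.range j))
  have he : ∀ i, e.symm (j i) = Sum.inl i := fun i => by
    rw [Equiv.symm_apply_eq]; simp [e]
  let g := bs.reindex e
  have hu : IsUnit (Matrix.of g : Matrix (Fin m) (Fin m) K) :=
    Matrix.linearIndependent_rows_iff_isUnit.1 g.linearIndependent
  refine ⟨hu.unit, fun i => ?_⟩
  change g (j i) = v i
  simp only [g, Module.Basis.reindex_apply, he, bs]
  simp [Module.Basis.sumExtend]
  rfl

theorem mul_single_mul_eq_vecMulVec {n : ℕ} (G : Matrix (Fin n) (Fin n) (ZMod 2)) (a b : Fin n) :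
    Gᵀ * Matrix.single a b 1 * G = Matrix.vecMulVec (G a) (G b) := by
  rw [Matrix.single_eq_single_vecMulVec_single, Matrix.mul_vecMulVec, Matrix.vecMulVec_mul]
  simp
  rfl

/-- Every alternating matrix over `𝔽₂` is congruent to a reduced matrix `B_s`. -/
theorem exists_congruent_reduced {n : ℕ} (B : Matrix (Fin n) (Fin n) (ZMod 2))
    (hB : B.IsSymm) (hd : ∀ i, B i i = 0) :
    ∃ (G : GL (Fin n) (ZMod 2)) (s : Fin (n / 2) → ZMod 2),
      B = G.valᵀ * (reduced s).val * G.val := by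
  obtain ⟨k, α, β, hli, hsum, -⟩ := exists_hyperbolic_decomposition B hB hd
  have hk : k ≤ n / 2 := by
    have := hli.fintype_card_le_finrank
    simp only [Fintype.card_sum, Fintype.card_fin, Module.finrank_fintype_fun_eq_card] at this
    omega
  let l : Fin k → Fin n := fun i => ⟨i, by omega⟩
  let r : Fin k → Fin n := fun i => ⟨i + n / 2, by omega⟩
  have hj : Function.Injective (Sum.elim l r) := by
    rintro (i | i) (j | j) h <;> simp [l, r, Fin.ext_iff] at h ⊢ <;> omega
  -- The hyperbolic pairs are placed at the positions `(i, i + n / 2)` prescribed by `reduced`.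
  obtain ⟨G, hG⟩ := exists_gl_rows_extending hli hj
  have hred : (reduced fun i : Fin (n / 2) => if i.val < k then 1 else 0).val =
      ∑ i, (Matrix.single (l i) (r i) 1 + Matrix.single (r i) (l i) (1 : ZMod 2)) := by
    ext a b
    simp only [reduced, reducedEntries, Matrix.of_apply, Matrix.sum_apply, Matrix.add_apply,
      Matrix.single_apply, l, r, Fin.ext_iff]
    by_cases h1 : a.val < k ∧ b.val = a.val + n / 2
    · rw [Finset.sum_eq_single (⟨a, h1.1⟩ : Fin k)]
      · have : ¬ (a.val + n / 2 = a.val ∧ a.val = b.val) := by omega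
        have h3 : a.val < n / 2 := by omega
        simp [h1.2, h3, h1.1]
        omega
      · intro i _ hi
        have : i.val ≠ a.val := fun h => hi (Fin.ext h)
        rw [if_neg (by omega), if_neg (by omega), add_zero]
      · simp
    · by_cases h2 : b.val < k ∧ a.val = b.val + n / 2
      · rw [Finset.sum_eq_single (⟨b, h2.1⟩ : Fin k)]
        · have h3 : b.val < n / 2 := by omega
          rw [dif_neg (by omega), dif_pos (by omega), if_pos h2.1, if_neg (by simp; omega),
            if_pos (by simp; omega), zero_add]
        · intro i _ hi
          have : i.val ≠ b.val := fun h => hi (Fin.ext h)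
          rw [if_neg (by omega), if_neg (by omega), add_zero]
        · simp
      · rw [Finset.sum_eq_zero]
        · split_ifs <;> first | rfl | (exfalso; omega)
        · intro i _
          have := i.2
          rw [if_neg (by omega), if_neg (by omega), add_zero]
  refine ⟨G, fun i => if i.val < k then 1 else 0, ?_⟩
  rw [hred, hsum, Finset.mul_sum, Finset.sum_mul]
  refine Finset.sum_congr rfl fun i _ => ?_
  rw [mul_add, add_mul, mul_single_mul_eq_vecMulVec, mul_single_mul_eq_vecMulVec]
  have h1 : G.val (l i) = α i := hG (Sum.inl i)
  have h2 : G.val (r i) = β i := hG (Sum.inr i)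
  rw [h1, h2]

/-- The decomposition `Q_S = P_b Z_B` with `b` the diagonal of `S`, followed by the reduction of
`B` by a congruence. The phase layer can be put on either side, because shears commute. -/
theorem shear_symm_eq {n : ℕ} {S : Matrix (Fin n) (Fin n) (ZMod 2)} (hS : S.IsSymm) :
    ∃ (b : Fin n → ZMod 2) (G : GL (Fin n) (ZMod 2)) (s : Fin (n / 2) → ZMod 2), ∀ p,
      shear S p = shear (Matrix.diagonal b) (xAct G⁻¹ (shear (reduced s).val (xAct G p))) ∧
      shear S p = xAct G⁻¹ (shear (reduced s).val (xAct G (shear (Matrix.diagonal b) p))) := by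
  obtain ⟨G, s, h⟩ := exists_congruent_reduced (S + Matrix.diagonal fun i => S i i)
    (hS.add (Matrix.isSymm_diagonal _)) fun i => by
      rw [Matrix.add_apply, Matrix.diagonal_apply_eq, CharTwo.add_self_eq_zero]
  refine ⟨fun i => S i i, G, s, fun p => ?_⟩
  rw [← shear_congruence, ← shear_congruence, ← shear_add, ← shear_add, ← h, add_assoc,
    ZModModule.add_self, add_zero, add_comm, add_assoc, ZModModule.add_self, add_zero]
  exact ⟨rfl, rfl⟩

/-! ### Normal form of symplectic maps -/

/-- A Hadamard layer brings the image of the Lagrangian subspace `{(0, v)}` into a position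
transverse to `{(0, z)}`: as long as the intersection contains a point `(0, z)` with `z i = 1`,
exchanging the `i`-th coordinates makes the intersection strictly smaller. -/
theorem IsSymp.exists_hAct_transverse {n : ℕ} {f : PhaseSpace n → PhaseSpace n} (hf : IsSymp f) :
    ∃ w, ∀ v, (hAct w (f (0, v))).1 = 0 → v = 0 := by
  classical
  induction hm : (Finset.univ.filter fun v => (f (0, v)).1 = 0).card using Nat.strong_induction_on
    generalizing f with
  | _ m ih =>
  by_cases h0 : ∀ v, (f (0, v)).1 = 0 → v = 0
  · exact ⟨0, fun v hv => h0 v (by simpa [hAct] using hv)⟩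
  push Not at h0
  obtain ⟨v, hv, hv0⟩ := h0
  obtain ⟨i, hi⟩ : ∃ i, (f (0, v)).2 i = 1 := by
    by_contra! h
    have hz : f (0, v) = 0 := Prod.ext hv
      (funext fun i => (zmod_two_eq_zero_or_one _).resolve_right (h i))
    have h00 : f 0 = 0 := by simpa using hf.map_add 0 0
    exact hv0 (congrArg Prod.snd (hf.injective (hz.trans h00.symm)))
  obtain ⟨w, hw⟩ := ih _ (by
      rw [← hm]
      refine Finset.card_lt_card (Finset.ssubset_iff_of_subset ?_ |>.2 ⟨v, ?_, ?_⟩)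
      · intro u hu
        simp only [Finset.mem_filter, Finset.mem_univ, true_and, Function.comp_apply] at hu ⊢
        have hne : ∀ j, j ≠ i → (f (0, u)).1 j = 0 := fun j hj => by
          simpa [hAct, hj] using congrFun hu j
        have h : (f (0, u)).1 i = 0 := by
          have := hf (0, u) (0, v)
          simp only [symp, hv, dotProduct_zero, add_zero, zero_dotProduct] at this
          rwa [dotProduct, Finset.sum_eq_single i (fun j _ hj => by rw [hne j hj, zero_mul])
            (by simp), hi, mul_one] at this
        funext j
        by_cases hj : j = i
        · rw [hj]; exact h
        · exact hne j hj
      · simpa using hv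
      · simp only [Finset.mem_filter, Finset.mem_univ, true_and, Function.comp_apply]
        intro h
        simpa [hAct, hv, hi] using congrFun h i) ((isSymp_hAct (Pi.single i 1)).comp hf) rfl
  exact ⟨w + Pi.single i 1, fun u hu => hw u (by rwa [Function.comp_apply, hAct_hAct])⟩

theorem exists_matrix_of_add {n : ℕ} {g : (Fin n → ZMod 2) → Fin n → ZMod 2}
    (hg : ∀ u v, g (u + v) = g u + g v) :
    ∃ M : Matrix (Fin n) (Fin n) (ZMod 2), ∀ v, g v = M *ᵥ v :=
  ⟨LinearMap.toMatrix' ((AddMonoidHom.mk' g hg).toZModLinearMap 2), fun v => by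
    rw [LinearMap.toMatrix'_mulVec]; rfl⟩

/-- The Bruhat-type decomposition of the symplectic group in which the Weyl group element on the
left has been absorbed into a Hadamard layer, so that the rest lies in the big cell. -/
theorem IsSymp.exists_bruhat {n : ℕ} {f : PhaseSpace n → PhaseSpace n} (hf : IsSymp f) :
    ∃ (w : Fin n → ZMod 2) (S T : Matrix (Fin n) (Fin n) (ZMod 2)) (E : GL (Fin n) (ZMod 2)),
      S.IsSymm ∧ T.IsSymm ∧ ∀ p, f p = hAct w (shear S (hAct 1 (xAct E (shear T p)))) := by
  have symm_of : ∀ M : Matrix (Fin n) (Fin n) (ZMod 2),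
      (∀ x y, x ⬝ᵥ (M *ᵥ y) + (M *ᵥ x) ⬝ᵥ y = 0) → M.IsSymm := fun M h => by
    refine Matrix.ext_of_mulVec_single fun i => dotProduct_eq _ _ fun u => ?_
    rw [mulVec_dotProduct_transpose, Matrix.transpose_transpose]
    exact CharTwo.add_eq_zero.1 (h _ _)
  obtain ⟨w, hw⟩ := hf.exists_hAct_transverse
  -- `g (0, v) = (A v, D v)` with `A` invertible by transversality, and `D A⁻¹` is symmetric
  -- because the image of `{(0, v)}` is isotropic.
  let g := hAct w ∘ f
  have hg : IsSymp g := (isSymp_hAct w).comp hf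
  have hadd : ∀ u v : Fin n → ZMod 2, g (0, u + v) = g (0, u) + g (0, v) := fun u v => by
    rw [← hg.map_add]; simp
  obtain ⟨A, hA⟩ := exists_matrix_of_add (g := fun v => (g (0, v)).1) fun u v => by
    rw [hadd]; rfl
  obtain ⟨D, hD⟩ := exists_matrix_of_add (g := fun v => (g (0, v)).2) fun u v => by
    rw [hadd]; rfl
  have hAu : IsUnit A := by
    refine Matrix.mulVec_injective_iff_isUnit.1 ?_
    intro u v huv
    refine sub_eq_zero.1 (hw (u - v) ?_)
    rw [← Matrix.mulVecLin_apply, ← Matrix.mulVecLin_apply] at huv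
    change (g (0, u - v)).1 = 0
    rw [hA, ← Matrix.mulVecLin_apply, map_sub, huv, sub_self]
  obtain ⟨A, rfl⟩ := hAu
  have hAA : A⁻¹.val * A.val = 1 := by rw [← Units.val_mul, inv_mul_cancel]; rfl
  have hAA' : A.val * A⁻¹.val = 1 := by rw [← Units.val_mul, mul_inv_cancel]; rfl
  have hS : (D * A⁻¹.val).IsSymm := by
    refine symm_of _ fun x y => ?_
    have := hg (0, A⁻¹.val *ᵥ x) (0, A⁻¹.val *ᵥ y)
    simpa [symp, hA, hD, Matrix.mulVec_mulVec, hAA'] using this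
  -- Removing the shear and exchanging `x` and `z` yields a map `k` that preserves `{(0, v)}`;
  -- such a map is block triangular, hence of the form `xAct E ∘ shear T`.
  let k := hAct 1 ∘ shear (D * A⁻¹.val) ∘ g
  have hk : IsSymp k := (isSymp_hAct _).comp ((isSymp_shear hS).comp hg)
  have hk2 : ∀ v, k (0, v) = (0, A.val *ᵥ v) := fun v => by
    have h1 : g (0, v) = (A.val *ᵥ v, D *ᵥ v) := Prod.ext (hA v) (hD v)
    simp only [k, Function.comp_apply, h1, hAct_one, shear, Matrix.mulVec_mulVec, mul_assoc, hAA,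
      mul_one, ZModModule.add_self, Prod.swap_prod_mk]
  have hadd' : ∀ u v : Fin n → ZMod 2, k (u + v, 0) = k (u, 0) + k (v, 0) := fun u v => by
    rw [← hk.map_add]; simp
  obtain ⟨E, hE⟩ := exists_matrix_of_add (g := fun v => (k (v, 0)).1) fun u v => by
    rw [hadd']; rfl
  obtain ⟨F, hF⟩ := exists_matrix_of_add (g := fun v => (k (v, 0)).2) fun u v => by
    rw [hadd']; rfl
  have hEA : E = (invTranspose A).val := by
    have h1 : Eᵀ * A.val = 1 := by
      refine Matrix.ext_of_mulVec_single fun i => dotProduct_eq _ _ fun u => ?_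
      have := hk (u, 0) (0, Pi.single i 1)
      simp only [symp, hk2, hE, mulVec_dotProduct_transpose, Matrix.mulVec_mulVec,
        dotProduct_zero, add_zero] at this
      rw [Matrix.one_mulVec, dotProduct_comm, this, dotProduct_comm]
    rw [← Matrix.transpose_transpose E, Units.eq_inv_of_mul_eq_one_right h1]
    rfl
  subst hEA
  have hT : (A⁻¹.val * F).IsSymm := by
    refine symm_of _ fun x y => ?_
    have h := hk (x, 0) (y, 0)
    have h2 : ∀ x y, (invTranspose A).val *ᵥ x ⬝ᵥ y = x ⬝ᵥ (A⁻¹.val *ᵥ y) := fun x y => by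
      rw [mulVec_dotProduct_transpose]; rfl
    rw [symp, hE, hE, hF, hF, h2, dotProduct_comm (F *ᵥ x), h2, dotProduct_comm y] at h
    simpa [symp, Matrix.mulVec_mulVec] using h
  refine ⟨w, D * A⁻¹.val, A⁻¹.val * F, invTranspose A, hS, hT, fun p => ?_⟩
  have hkp : k p = xAct (invTranspose A) (shear (A⁻¹.val * F) p) := by
    have h1 : k (p.1, 0) = ((invTranspose A).val *ᵥ p.1, F *ᵥ p.1) := Prod.ext (hE _) (hF _)
    have h2 : (invTranspose A)⁻¹.val = A.valᵀ := rfl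
    have h3 : p = (p.1, 0) + (0, p.2) := by simp
    conv_lhs => rw [h3, hk.map_add, h1, hk2]
    simp only [xAct, shear, h2, Matrix.transpose_transpose, Matrix.mulVec_add,
      Matrix.mulVec_mulVec, ← mul_assoc, hAA', one_mul]
    simp [add_comm]
  rw [← hkp]
  simp only [k, g, Function.comp_apply, hAct_self, shear_self]

/-- The normal form of `mainTheorem2`, up to Pauli operators and phases. -/
theorem IsSymp.exists_normalForm {n : ℕ} {f : PhaseSpace n → PhaseSpace n} (hf : IsSymp f) :
    ∃ (w b d : Fin n → ZMod 2) (s s' : Fin (n / 2) → ZMod 2) (A₁ A₂ A₃ : GL (Fin n) (ZMod 2)),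
      ∀ p, f p = hAct w (shear (Matrix.diagonal b) (xAct A₁ (shear (reduced s).val (hAct 1
        (xAct A₂ (shear (reduced s').val (xAct A₃ (shear (Matrix.diagonal d) p)))))))) := by
  obtain ⟨w, S, T, E, hS, hT, h⟩ := hf.exists_bruhat
  obtain ⟨b, G, s, hb⟩ := shear_symm_eq hS
  obtain ⟨d, G', s', hd⟩ := shear_symm_eq hT
  refine ⟨w, b, d, s, s', G⁻¹, invTranspose G * E * G'⁻¹, G', fun p => ?_⟩
  rw [h, (hb _).1, (hd _).2, xAct_hAct_one, xAct_mul, xAct_mul]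

/-! ### Pauli operators -/

/-- The sign `(-1)^t` of `t ∈ 𝔽₂`. -/
def sgn (t : ZMod 2) : ℂ := (-1) ^ t.val

/-- The Pauli operator `X_x Z_z` labelled by the phase space point `p = (x, z)`. -/
def pauli {n : ℕ} (p : PhaseSpace n) : Op n := onQubits pauliX p.1 * onQubits pauliZ p.2

@[simp] theorem sgn_zero : sgn 0 = 1 := by simp [sgn]

@[simp] theorem sgn_one : sgn 1 = -1 := by simp [sgn, ZMod.val_one]

theorem sgn_add (s t : ZMod 2) : sgn (s + t) = sgn s * sgn t := by
  rcases zmod_two_eq_zero_or_one s with rfl | rfl <;>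
    rcases zmod_two_eq_zero_or_one t with rfl | rfl <;> simp [CharTwo.add_self_eq_zero]

theorem sgn_ne_zero (t : ZMod 2) : sgn t ≠ 0 := pow_ne_zero _ (by norm_num)

theorem sgn_injective : Function.Injective sgn := by
  intro s t h
  rcases zmod_two_eq_zero_or_one s with rfl | rfl <;>
    rcases zmod_two_eq_zero_or_one t with rfl | rfl <;> simp at h ⊢ <;> norm_num at h

theorem sgn_sum {ι : Type*} (s : Finset ι) (f : ι → ZMod 2) :
    sgn (∑ i ∈ s, f i) = ∏ i ∈ s, sgn (f i) := by
  classical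
  induction s using Finset.induction_on with
  | empty => simp
  | insert a s ha ih => rw [Finset.sum_insert ha, Finset.prod_insert ha, sgn_add, ih]

theorem onQubits_pauliX_apply {n : ℕ} (x a b : Fin n → ZMod 2) :
    onQubits pauliX x a b = if a = b + x then 1 else 0 := by
  have key : ∀ i, (if x i = 1 then pauliX else 1) (a i) (b i) =
      if a i = b i + x i then (1 : ℂ) else 0 := fun i => by
    generalize x i = x; generalize a i = a; generalize b i = b
    rcases zmod_two_eq_zero_or_one x with rfl | rfl <;>
      rcases zmod_two_eq_zero_or_one a with rfl | rfl <;>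
      rcases zmod_two_eq_zero_or_one b with rfl | rfl <;>
      simp [pauliX, qubitOp, CharTwo.add_self_eq_zero]
  simp only [onQubits, tensor, Matrix.of_apply, key, Finset.prod_ite_zero, funext_iff,
    Pi.add_apply]
  simp

theorem onQubits_pauliZ_eq_diagonal {n : ℕ} (z : Fin n → ZMod 2) :
    onQubits pauliZ z = Matrix.diagonal fun b => sgn (z ⬝ᵥ b) := by
  have key : ∀ (a b : Fin n → ZMod 2) (i), (if z i = 1 then pauliZ else 1) (a i) (b i) =
      if a i = b i then sgn (z i * a i) else 0 := fun a b i => by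
    generalize z i = x; generalize a i = a; generalize b i = b
    rcases zmod_two_eq_zero_or_one x with rfl | rfl <;>
      rcases zmod_two_eq_zero_or_one a with rfl | rfl <;>
      rcases zmod_two_eq_zero_or_one b with rfl | rfl <;>
      simp [pauliZ, qubitOp]
  ext a b
  simp only [onQubits, tensor, Matrix.of_apply, key, Finset.prod_ite_zero, Matrix.diagonal_apply,
    funext_iff, dotProduct, sgn_sum]
  simp

theorem pauli_apply {n : ℕ} (p : PhaseSpace n) (a b : Fin n → ZMod 2) :
    pauli p a b = if a = b + p.1 then sgn (p.2 ⬝ᵥ b) else 0 := by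
  rw [pauli, onQubits_pauliZ_eq_diagonal, Matrix.mul_diagonal, onQubits_pauliX_apply]
  simp

theorem mul_pauli_apply {n : ℕ} (C : Op n) (p : PhaseSpace n) (a b : Fin n → ZMod 2) :
    (C * pauli p) a b = C a (b + p.1) * sgn (p.2 ⬝ᵥ b) := by
  simp [Matrix.mul_apply, pauli_apply]

theorem pauli_mul_apply {n : ℕ} (C : Op n) (p : PhaseSpace n) (a b : Fin n → ZMod 2) :
    (pauli p * C) a b = sgn (p.2 ⬝ᵥ (a + p.1)) * C (a + p.1) b := by
  rw [Matrix.mul_apply, Finset.sum_eq_single (a + p.1)]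
  · rw [pauli_apply, if_pos]
    rw [add_assoc, ZModModule.add_self, add_zero]
  · intro c _ hc
    rw [pauli_apply, if_neg, zero_mul]
    rintro rfl
    exact hc (by rw [add_assoc, ZModModule.add_self, add_zero])
  · simp

/-! ### The action of operators on Pauli operators -/

/-- The operator `C` permutes the Pauli operators by conjugation, up to scalars, in the way
described by `f`. -/
def Acts {n : ℕ} (C : Op n) (f : PhaseSpace n → PhaseSpace n) : Prop :=
  ∀ p, ∃ c : ℂ, c ≠ 0 ∧ C * pauli p = c • (pauli (f p) * C)

theorem acts_one {n : ℕ} : Acts (1 : Op n) id := fun p => ⟨1, one_ne_zero, by simp⟩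

theorem Acts.mul {n : ℕ} {C D : Op n} {f g : PhaseSpace n → PhaseSpace n} (hC : Acts C f)
    (hD : Acts D g) : Acts (C * D) (f ∘ g) := fun p => by
  obtain ⟨d, hd, h⟩ := hD p
  obtain ⟨c, hc, h'⟩ := hC (g p)
  refine ⟨d * c, mul_ne_zero hd hc, ?_⟩
  rw [mul_assoc, h, Matrix.mul_smul, ← mul_assoc, h', Matrix.smul_mul, smul_smul, mul_assoc]
  rfl

theorem Acts.inv {n : ℕ} {C D : Op n} {f g : PhaseSpace n → PhaseSpace n} (hC : Acts C f)
    (hCD : C * D = 1) (hDC : D * C = 1) (hfg : ∀ p, f (g p) = p) : Acts D g := fun p => by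
  obtain ⟨c, hc, h⟩ := hC (g p)
  refine ⟨c⁻¹, inv_ne_zero hc, ?_⟩
  have h2 : D * (C * pauli (g p)) * D = D * (c • (pauli p * C)) * D := by rw [h, hfg]
  rw [← mul_assoc, hDC, one_mul, Matrix.mul_smul, Matrix.smul_mul, ← mul_assoc, mul_assoc _ C,
    hCD, mul_one] at h2
  rw [h2, smul_smul, inv_mul_cancel₀ hc, one_smul]

/-- The Pauli operator on one qubit labelled by `(x, z)`. -/
def qubitPauli (x z : ZMod 2) : Matrix (ZMod 2) (ZMod 2) ℂ :=
  (if x = 1 then pauliX else 1) * (if z = 1 then pauliZ else 1)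

theorem pauli_eq_tensor {n : ℕ} (p : PhaseSpace n) :
    pauli p = tensor fun i => qubitPauli (p.1 i) (p.2 i) := by
  rw [pauli, onQubits, onQubits, tensor_mul]
  rfl

theorem tensor_smul {n : ℕ} (c : Fin n → ℂ) (M : Fin n → Matrix (ZMod 2) (ZMod 2) ℂ) :
    (tensor fun i => c i • M i) = (∏ i, c i) • tensor M := by
  ext a b
  simp [tensor, Finset.prod_mul_distrib]

/-- A tensor product of one-qubit operators acts on each coordinate separately. -/
theorem acts_tensor {n : ℕ} {U : Fin n → Matrix (ZMod 2) (ZMod 2) ℂ}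
    {f : PhaseSpace n → PhaseSpace n}
    (h : ∀ p i, ∃ c : ℂ, c ≠ 0 ∧ U i * qubitPauli (p.1 i) (p.2 i) =
      c • (qubitPauli ((f p).1 i) ((f p).2 i) * U i)) : Acts (tensor U) f := fun p => by
  choose c hc h using h p
  refine ⟨∏ i, c i, Finset.prod_ne_zero_iff.2 fun i _ => hc i, ?_⟩
  rw [pauli_eq_tensor, pauli_eq_tensor, tensor_mul, tensor_mul, ← tensor_smul]
  exact congrArg tensor (funext h)

theorem qubitOp_smul (c p q r t : ℂ) : c • qubitOp p q r t = qubitOp (c * p) (c * q) (c * r)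
    (c * t) := by
  ext a b
  simp only [qubitOp, Matrix.smul_apply, Matrix.of_apply, smul_eq_mul]
  split_ifs <;> rfl

theorem neg_qubitOp (p q r t : ℂ) : -qubitOp p q r t = qubitOp (-p) (-q) (-r) (-t) := by
  rw [← neg_one_smul ℂ, qubitOp_smul]
  simp

theorem acts_hadamard {n : ℕ} (w : Fin n → ZMod 2) : Acts (onQubits hadamard w) (hAct w) := by
  refine acts_tensor fun p i => ⟨sgn (w i * (p.1 i * p.2 i)), sgn_ne_zero _, ?_⟩
  simp only [hAct, Pi.add_apply, Pi.mul_apply]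
  generalize w i = w; generalize p.1 i = x; generalize p.2 i = z
  rcases zmod_two_eq_zero_or_one w with rfl | rfl <;>
    rcases zmod_two_eq_zero_or_one x with rfl | rfl <;>
    rcases zmod_two_eq_zero_or_one z with rfl | rfl <;>
    simp [qubitPauli, hadamard, pauliX, pauliZ, qubitOp_mul, qubitOp_smul, neg_qubitOp,
      CharTwo.add_self_eq_zero]

theorem acts_phase {n : ℕ} (b : Fin n → ZMod 2) :
    Acts (onQubits phase b) (shear (Matrix.diagonal b)) := by
  refine acts_tensor fun p i => ⟨Complex.I ^ (b i * p.1 i).val, pow_ne_zero _ Complex.I_ne_zero, ?_⟩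
  simp only [shear, Pi.add_apply, Matrix.mulVec_diagonal]
  generalize b i = w; generalize p.1 i = x; generalize p.2 i = z
  rcases zmod_two_eq_zero_or_one w with rfl | rfl <;>
    rcases zmod_two_eq_zero_or_one x with rfl | rfl <;>
    rcases zmod_two_eq_zero_or_one z with rfl | rfl <;>
    simp [qubitPauli, phase, pauliX, pauliZ, qubitOp_mul, qubitOp_smul, ZMod.val_one,
      CharTwo.add_self_eq_zero]

theorem acts_cnotLayer {n : ℕ} (A : GL (Fin n) (ZMod 2)) : Acts (cnotLayer A) (xAct A) := by
  refine fun p => ⟨1, one_ne_zero, ?_⟩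
  rw [one_smul]
  ext a b
  rw [mul_pauli_apply, pauli_mul_apply]
  have h1 : a = A.val *ᵥ (b + p.1) ↔ a + (xAct A p).1 = A.val *ᵥ b := by
    simp only [xAct, Matrix.mulVec_add]
    constructor
    · rintro rfl
      rw [add_assoc, ZModModule.add_self, add_zero]
    · intro h
      rw [← h, add_assoc, ZModModule.add_self, add_zero]
  simp only [cnotLayer, Matrix.of_apply, h1]
  split_ifs with h
  · rw [h, one_mul, mul_one, xAct, mulVec_dotProduct_transpose, Matrix.transpose_transpose,
      Matrix.mulVec_mulVec, ← Units.val_mul, inv_mul_cancel]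
    simp
  · simp

/-- The quadratic form `∑_{i<j} B_ij b_i b_j` of the circuit `Z_B`. -/
def czForm {n : ℕ} (B : SymmZeroDiag n) (b : Fin n → ZMod 2) : ZMod 2 :=
  ∑ p ∈ czPairs B, b p.1 * b p.2

theorem czLayer_eq_diagonal {n : ℕ} (B : SymmZeroDiag n) :
    czLayer B = Matrix.diagonal fun b => sgn (czForm B b) := by
  have : ∀ (s : Finset (Fin n × Fin n)) (hc), s.noncommProd (fun p => czGate p.1 p.2) hc =
      Matrix.diagonal fun b => sgn (∑ p ∈ s, b p.1 * b p.2) := by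
    intro s
    classical
    induction s using Finset.induction_on with
    | empty => intro; simp
    | insert a s ha ih =>
      intro hc
      rw [Finset.noncommProd_insert_of_notMem _ _ _ _ ha, ih, czGate, Matrix.diagonal_mul_diagonal]
      simp only [Finset.sum_insert ha, sgn_add]
      rfl
  exact this _ _

/-- The polarization of `czForm B` is the bilinear form of `B`. -/
theorem czForm_add {n : ℕ} (B : SymmZeroDiag n) (x y : Fin n → ZMod 2) :
    czForm B (x + y) = czForm B x + czForm B y + x ⬝ᵥ (B.val *ᵥ y) := by
  have key : ∑ p ∈ czPairs B, (x p.1 * y p.2 + x p.2 * y p.1) = x ⬝ᵥ (B.val *ᵥ y) := by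
    have h1 : x ⬝ᵥ (B.val *ᵥ y) = ∑ p : Fin n × Fin n, x p.1 * B.val p.1 p.2 * y p.2 := by
      simp only [dotProduct, Matrix.mulVec, Finset.mul_sum, Fintype.sum_prod_type, mul_assoc]
    have h2 : ∀ p : Fin n × Fin n, x p.1 * B.val p.1 p.2 * y p.2 =
        (if p ∈ czPairs B then x p.1 * y p.2 else 0) +
          (if p.swap ∈ czPairs B then x p.1 * y p.2 else 0) := by
      rintro ⟨i, j⟩
      have hs := B.2.1.apply i j
      have hd := B.2.2
      simp only [czPairs, Finset.mem_filter, Finset.mem_univ, true_and, Prod.fst_swap,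
        Prod.snd_swap, hs]
      rcases zmod_two_eq_zero_or_one (B.val i j) with h | h
      · simp [h]
      · rcases lt_trichotomy i j with hij | rfl | hij
        · simp [h, hij, hij.not_gt]
        · rw [hd] at h; exact absurd h (by decide)
        · simp [h, hij, hij.not_gt]
    have h3 : ∑ p : Fin n × Fin n, (if p.swap ∈ czPairs B then x p.1 * y p.2 else 0) =
        ∑ p : Fin n × Fin n, (if p ∈ czPairs B then x p.2 * y p.1 else 0) :=
      Fintype.sum_equiv (Equiv.prodComm _ _) _ _ fun p => rfl
    rw [Finset.sum_add_distrib, h1, Finset.sum_congr rfl fun p _ => h2 p, Finset.sum_add_distrib,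
      h3]
    simp
  rw [← key, czForm, czForm, czForm, ← Finset.sum_add_distrib, ← Finset.sum_add_distrib]
  refine Finset.sum_congr rfl fun p _ => ?_
  simp only [Pi.add_apply]
  ring

theorem acts_czLayer {n : ℕ} (B : SymmZeroDiag n) : Acts (czLayer B) (shear B.val) := by
  refine fun p => ⟨sgn (czForm B p.1), sgn_ne_zero _, ?_⟩
  rw [czLayer_eq_diagonal]
  ext a b
  rw [Matrix.smul_apply, mul_pauli_apply, pauli_mul_apply, Matrix.diagonal_apply,
    Matrix.diagonal_apply, smul_eq_mul]
  have h1 : a = b + p.1 ↔ a + (shear B.val p).1 = b := by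
    simp only [shear]
    constructor
    · rintro rfl
      rw [add_assoc, ZModModule.add_self, add_zero]
    · rintro rfl
      rw [add_assoc, ZModModule.add_self, add_zero]
  simp only [h1]
  split_ifs with h
  · rw [h, h1.2 h, czForm_add, shear, add_dotProduct, mulVec_dotProduct_transpose, B.2.1.eq,
      dotProduct_comm b, mulVec_dotProduct_transpose, B.2.1.eq, sgn_add, sgn_add, sgn_add]
    ring
  · simp

theorem cnotGate_eq_cnotLayer {n : ℕ} {i j : Fin n} (h : i ≠ j) :
    ∃ A : GL (Fin n) (ZMod 2), cnotGate i j = cnotLayer A := by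
  have hu : IsUnit (Matrix.transvection i j (1 : ZMod 2)) := by
    rw [Matrix.isUnit_iff_isUnit_det, Matrix.det_transvection_of_ne i j h]
    exact isUnit_one
  refine ⟨hu.unit, ?_⟩
  ext a b
  have : Matrix.transvection i j (1 : ZMod 2) *ᵥ b = Function.update b i (b i + b j) := by
    ext k
    rw [Matrix.transvection, Matrix.add_mulVec, Matrix.one_mulVec, Pi.add_apply]
    by_cases hk : k = i
    · subst hk
      simp [Matrix.single_mulVec]
    · simp [Matrix.single_mulVec, hk]
  simp [cnotGate, cnotLayer, this]

/-- Every character of the group `𝔽₂ⁿ` is of the form `x ↦ (-1)^(v · x)`. -/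
theorem exists_sgn_of_mul {n : ℕ} {c : (Fin n → ZMod 2) → ℂ} (h0 : ∀ x, c x ≠ 0)
    (hadd : ∀ x y, c (x + y) = c x * c y) : ∃ v, ∀ x, c x = sgn (v ⬝ᵥ x) := by
  have h1 : c 0 = 1 := by
    have := hadd 0 0
    rw [add_zero] at this
    exact mul_left_cancel₀ (h0 0) (by rw [← this, mul_one])
  have hsq : ∀ x, c x = 1 ∨ c x = -1 := fun x => by
    rw [← mul_self_eq_one_iff, ← hadd, ZModModule.add_self, h1]
  have hex : ∀ x, ∃ t, c x = sgn t := fun x => by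
    rcases hsq x with h | h
    · exact ⟨0, by simp [h]⟩
    · exact ⟨1, by simp [h]⟩
  choose t ht using hex
  let φ := (AddMonoidHom.mk' t fun x y =>
    sgn_injective (by rw [← ht, hadd, sgn_add, ht, ht])).toZModLinearMap 2
  refine ⟨(dotProductEquiv (ZMod 2) (Fin n)).symm φ, fun x => ?_⟩
  have : dotProductEquiv (ZMod 2) (Fin n) ((dotProductEquiv (ZMod 2) (Fin n)).symm φ) x =
      φ x := by
    rw [LinearEquiv.apply_symm_apply]
  rw [ht, ← dotProductEquiv_apply_apply, this]
  rfl

/-- An operator that commutes with all Pauli operators up to scalars is a multiple of a Pauli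
operator: commutation with the `Z_v` confines the nonzero entries `(a, b)` to the
positions with `a + b = u` for a fixed `u`, and commutation with the `X_x` determines these entries
up to a common scalar. -/
theorem Acts.eq_smul_pauli {n : ℕ} {C : Op n} (hC : Acts C id) :
    ∃ (c : ℂ) (q : PhaseSpace n), C = c • pauli q := by
  by_cases hC0 : C = 0
  · exact ⟨0, 0, by simp [hC0]⟩
  obtain ⟨a₀, b₀, hab⟩ : ∃ a b, C a b ≠ 0 := by
    by_contra! h
    exact hC0 (Matrix.ext h)
  choose c hc h using hC
  have hz : ∀ v a b, C a b * sgn (v ⬝ᵥ b) = c (0, v) * (sgn (v ⬝ᵥ a) * C a b) := fun v a b => by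
    have := congrFun₂ (h (0, v)) a b
    rw [Matrix.smul_apply, mul_pauli_apply, pauli_mul_apply] at this
    simpa using this
  have hx : ∀ x a b, C a (b + x) = c (x, 0) * C (a + x) b := fun x a b => by
    have := congrFun₂ (h (x, 0)) a b
    rw [Matrix.smul_apply, mul_pauli_apply, pauli_mul_apply] at this
    simpa using this
  have hcv : ∀ v a b, C a b ≠ 0 → c (0, v) = sgn (v ⬝ᵥ (a + b)) := fun v a b hne => by
    have h1 := hz v a b
    have h2 : sgn (v ⬝ᵥ a) * sgn (v ⬝ᵥ a) = 1 := by
      rw [← sgn_add, CharTwo.add_self_eq_zero, sgn_zero]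
    rw [dotProduct_add, sgn_add]
    refine mul_right_cancel₀ hne ?_
    linear_combination -(sgn (v ⬝ᵥ a)) * h1 - c (0, v) * C a b * h2
  obtain ⟨u, hu⟩ : ∃ u, u = a₀ + b₀ := ⟨_, rfl⟩
  have hsupp : ∀ a b, C a b ≠ 0 → a = b + u := fun a b hne => by
    have : a + b = u := dotProduct_eq _ _ fun v => by
      rw [dotProduct_comm, dotProduct_comm u]
      exact sgn_injective (by rw [hu, ← hcv v a b hne, ← hcv v a₀ b₀ hab])
    rw [← this, add_comm a, ← add_assoc, ZModModule.add_self, zero_add]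
  have hg : ∀ x, C (x + u) x = c (x, 0) * C u 0 := fun x => by
    have := hx x (x + u) 0
    rwa [zero_add, add_comm x, add_assoc, ZModModule.add_self, add_zero, add_comm u] at this
  have hu0 : C u 0 ≠ 0 := fun h0 => hab (by
    have := hg b₀
    rwa [h0, mul_zero, hu, add_comm, add_assoc, ZModModule.add_self, add_zero] at this)
  obtain ⟨v, hv⟩ := exists_sgn_of_mul (c := fun x => c (x, 0)) (fun x => hc _) fun x y => by
    refine mul_right_cancel₀ hu0 ?_
    have h1 := hx y (x + y + u) x
    have h2 : x + y + u + y = x + u := by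
      rw [add_right_comm, add_assoc x, ZModModule.add_self, add_zero]
    rw [h2, hg, hg] at h1
    rw [h1]
    ring
  refine ⟨C u 0, (u, v), ?_⟩
  ext a b
  rw [Matrix.smul_apply, pauli_apply, smul_eq_mul]
  split_ifs with hab
  · subst hab
    rw [hg, ← hv, mul_comm]
  · rw [mul_zero]
    by_contra hne
    exact hab (hsupp a b hne)

/-! ### The ring `ℤ[ζ₈, 1/2]` -/

/-- The primitive eighth root of unity `e^{iπ/4}`. -/
def zeta : ℂ := Complex.exp (Complex.I * (Real.pi / 4 : ℝ))

theorem zeta_pow (k : ℕ) : zeta ^ k = Complex.exp (Complex.I * (k * (Real.pi / 4) : ℝ)) := by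
  rw [zeta, ← Complex.exp_nat_mul]
  push_cast
  ring_nf

theorem zeta_sq : zeta ^ 2 = Complex.I := by
  rw [zeta_pow]
  nth_rw 2 [← Complex.exp_pi_div_two_mul_I]
  congr 1
  push_cast
  ring

theorem zeta_pow_four : zeta ^ 4 = -1 := by
  rw [show (4 : ℕ) = 2 * 2 from rfl, pow_mul, zeta_sq, Complex.I_sq]

theorem star_zeta : star zeta = -zeta ^ 3 := by
  have h : zeta * star zeta = 1 := by
    rw [zeta, RCLike.star_def, ← Complex.exp_conj, ← Complex.exp_add, map_mul, Complex.conj_I,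
      Complex.conj_ofReal, neg_mul, add_neg_cancel, Complex.exp_zero]
  linear_combination (-zeta ^ 3) * h + star zeta * zeta_pow_four

theorem zeta_sub_zeta_pow_three : zeta - zeta ^ 3 = ((√2 : ℝ) : ℂ) := by
  have h : zeta + star zeta = ((√2 : ℝ) : ℂ) := by
    rw [RCLike.star_def, Complex.add_conj, zeta, mul_comm Complex.I, Complex.exp_ofReal_mul_I_re,
      Real.cos_pi_div_four]
    push_cast
    ring
  rw [← h, star_zeta]
  ring

/-- The ring `ℤ[ζ₈, 1/2]`, which contains all entries of all stabilizer circuits. -/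
def dyadicCyclotomic : Subring ℂ where
  carrier := {x | ∃ (k : ℕ) (a b c d : ℤ),
    2 ^ k * x = a + b * zeta + c * zeta ^ 2 + d * zeta ^ 3}
  zero_mem' := ⟨0, 0, 0, 0, 0, by simp⟩
  one_mem' := ⟨0, 1, 0, 0, 0, by simp⟩
  add_mem' := by
    rintro x y ⟨k, a, b, c, d, hx⟩ ⟨l, a', b', c', d', hy⟩
    refine ⟨k + l, 2 ^ l * a + 2 ^ k * a', 2 ^ l * b + 2 ^ k * b', 2 ^ l * c + 2 ^ k * c',
      2 ^ l * d + 2 ^ k * d', ?_⟩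
    push_cast
    linear_combination 2 ^ l * hx + 2 ^ k * hy
  neg_mem' := by
    rintro x ⟨k, a, b, c, d, hx⟩
    refine ⟨k, -a, -b, -c, -d, ?_⟩
    push_cast
    linear_combination -hx
  mul_mem' := by
    rintro x y ⟨k, a, b, c, d, hx⟩ ⟨l, a', b', c', d', hy⟩
    refine ⟨k + l, a * a' - b * d' - c * c' - d * b', a * b' + b * a' - c * d' - d * c',
      a * c' + b * b' + c * a' - d * d', a * d' + b * c' + c * b' + d * a', ?_⟩
    push_cast
    linear_combination 2 ^ l * y * hx + (a + b * zeta + c * zeta ^ 2 + d * zeta ^ 3) * hy +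
      (b * d' + c * c' + d * b' + (c * d' + d * c') * zeta + d * d' * zeta ^ 2) * zeta_pow_four

theorem star_mem_dyadicCyclotomic {x : ℂ} (hx : x ∈ dyadicCyclotomic) :
    star x ∈ dyadicCyclotomic := by
  obtain ⟨k, a, b, c, d, h⟩ := hx
  refine ⟨k, a, -d, -c, -b, ?_⟩
  have := congrArg star h
  simp only [star_mul', star_add, star_pow, star_zeta, star_intCast, star_ofNat] at this
  rw [this]
  push_cast
  linear_combination (c * zeta ^ 2 - d * zeta * (zeta ^ 4 - 1)) * zeta_pow_four

theorem I_mem_dyadicCyclotomic : Complex.I ∈ dyadicCyclotomic :=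
  ⟨0, 0, 0, 1, 0, by simp [zeta_sq]⟩

theorem inv_sqrt_two_mem_dyadicCyclotomic : ((1 / √2 : ℝ) : ℂ) ∈ dyadicCyclotomic := by
  refine ⟨1, 0, 1, 0, -1, ?_⟩
  have h : (2 : ℝ) * (1 / √2) = √2 := by
    rw [mul_one_div, Real.div_sqrt]
  have h' : (2 : ℂ) * ((1 / √2 : ℝ) : ℂ) = ((√2 : ℝ) : ℂ) := by
    exact_mod_cast congrArg Complex.ofReal h
  rw [pow_one, h', ← zeta_sub_zeta_pow_three]
  push_cast
  ring

/-- Descent modulo 4 for the two equations expressing `|a + bζ + cζ² + dζ³| = 2^k`. -/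
theorem exists_eq_two_pow_mul (k : ℕ) (a b c d : ℤ) (h : a ^ 2 + b ^ 2 + c ^ 2 + d ^ 2 = 4 ^ k)
    (h' : a * b + b * c + c * d = d * a) :
    ∃ a' b' c' d' : ℤ, a = 2 ^ k * a' ∧ b = 2 ^ k * b' ∧ c = 2 ^ k * c' ∧ d = 2 ^ k * d' ∧
      a' ^ 2 + b' ^ 2 + c' ^ 2 + d' ^ 2 = 1 := by
  induction k generalizing a b c d with
  | zero => exact ⟨a, b, c, d, by simp, by simp, by simp, by simp, by simpa using h⟩
  | succ k ih =>
    have key : ∀ a b c d : ZMod 4, a ^ 2 + b ^ 2 + c ^ 2 + d ^ 2 = 0 →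
        a * b + b * c + c * d = d * a → 2 * a = 0 ∧ 2 * b = 0 ∧ 2 * c = 0 ∧ 2 * d = 0 := by
      decide
    have h4 : (4 : ZMod 4) = 0 := rfl
    have even : ∀ x : ℤ, 2 * (x : ZMod 4) = 0 → ∃ y, x = 2 * y := fun x hx => by
      have := (ZMod.intCast_zmod_eq_zero_iff_dvd (2 * x) 4).1 (by exact_mod_cast hx)
      exact ⟨x / 2, by omega⟩
    obtain ⟨ha, hb, hc, hd⟩ := key a b c d
      (by have := congrArg (Int.cast : ℤ → ZMod 4) h
          push_cast at this
          rw [this, pow_succ, h4, mul_zero])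
      (by exact_mod_cast congrArg (Int.cast : ℤ → ZMod 4) h')
    obtain ⟨a, rfl⟩ := even a ha
    obtain ⟨b, rfl⟩ := even b hb
    obtain ⟨c, rfl⟩ := even c hc
    obtain ⟨d, rfl⟩ := even d hd
    obtain ⟨a', b', c', d', rfl, rfl, rfl, rfl, h1⟩ := ih a b c d
      (by rw [pow_succ (4 : ℤ) k] at h; linarith) (by linarith)
    exact ⟨a', b', c', d', by ring, by ring, by ring, by ring, h1⟩

theorem exists_eq_zeta_pow_of_sum_sq_eq_one {a b c d : ℤ}
    (h : a ^ 2 + b ^ 2 + c ^ 2 + d ^ 2 = 1) :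
    ∃ k : ℕ, (a : ℂ) + b * zeta + c * zeta ^ 2 + d * zeta ^ 3 = zeta ^ k := by
  have h4 : ∀ j, zeta ^ (j + 4) = -zeta ^ j := fun j => by rw [pow_add, zeta_pow_four, mul_neg_one]
  have small : ∀ t : ℤ, t ^ 2 ≤ 1 → t = 0 ∨ t = 1 ∨ t = -1 := fun t h => by
    have h1 : t ≤ 1 := by nlinarith
    have h2 : -1 ≤ t := by nlinarith
    omega
  have ha := sq_nonneg a
  have hb := sq_nonneg b
  have hc := sq_nonneg c
  have hd := sq_nonneg d
  rcases small a (by linarith) with rfl | rfl | rfl <;>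
    rcases small b (by linarith) with rfl | rfl | rfl <;>
    rcases small c (by linarith) with rfl | rfl | rfl <;>
    rcases small d (by linarith) with rfl | rfl | rfl <;>
    first
    | (exfalso; norm_num at h; done)
    | (refine ⟨0, ?_⟩; simp; done)
    | (refine ⟨1, ?_⟩; simp; done)
    | (refine ⟨2, ?_⟩; simp; done)
    | (refine ⟨3, ?_⟩; simp; done)
    | (refine ⟨0 + 4, ?_⟩; rw [h4]; simp; done)
    | (refine ⟨1 + 4, ?_⟩; rw [h4]; simp; done)
    | (refine ⟨2 + 4, ?_⟩; rw [h4]; simp; done)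
    | (refine ⟨3 + 4, ?_⟩; rw [h4]; simp)

/-- The elements of absolute value `1` of `ℤ[ζ₈, 1/2]` are the eighth roots of unity. -/
theorem exists_eq_zeta_pow {x : ℂ} (hx : x ∈ dyadicCyclotomic) (h1 : star x * x = 1) :
    ∃ k : ℕ, x = zeta ^ k := by
  obtain ⟨k, a, b, c, d, h⟩ := hx
  have hs := congrArg star h
  simp only [star_mul', star_add, star_pow, star_zeta, star_intCast, star_ofNat] at hs
  have hnorm : (4 : ℂ) ^ k = (a + b * zeta + c * zeta ^ 2 + d * zeta ^ 3) *
      (a - b * zeta ^ 3 - c * zeta ^ 2 - d * zeta) := by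
    have h2 : (4 : ℂ) ^ k = (2 ^ k * x) * (2 ^ k * star x) := by
      rw [show (4 : ℂ) = 2 * 2 by norm_num, mul_pow]
      linear_combination -(2 ^ k * 2 ^ k) * h1
    rw [h2, hs, h]
    linear_combination (a + b * zeta + c * zeta ^ 2 + d * zeta ^ 3) *
      (c * zeta ^ 2 - d * zeta * (zeta ^ 4 - 1)) * zeta_pow_four
  have hN : ((a ^ 2 + b ^ 2 + c ^ 2 + d ^ 2 - 4 ^ k : ℤ) : ℂ) +
      ((a * b + b * c + c * d - d * a : ℤ) : ℂ) * ((√2 : ℝ) : ℂ) = 0 := by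
    rw [← zeta_sub_zeta_pow_three]
    push_cast
    linear_combination -hnorm +
      (b ^ 2 + c ^ 2 + d ^ 2 + (b * c + c * d) * zeta + b * d * zeta ^ 2) * zeta_pow_four
  -- `√2` is irrational, so both coefficients vanish.
  have hM : a * b + b * c + c * d - d * a = 0 := by
    by_contra hM
    have hN' : ((a ^ 2 + b ^ 2 + c ^ 2 + d ^ 2 - 4 ^ k : ℤ) : ℝ) +
        ((a * b + b * c + c * d - d * a : ℤ) : ℝ) * √2 = 0 := by exact_mod_cast hN
    exact (irrational_sqrt_two.intCast_mul hM).intCast_add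
      (a ^ 2 + b ^ 2 + c ^ 2 + d ^ 2 - 4 ^ k) ⟨0, by rw [hN', Rat.cast_zero]⟩
  rw [hM, Int.cast_zero, zero_mul, add_zero, Int.cast_eq_zero] at hN
  obtain ⟨a', b', c', d', rfl, rfl, rfl, rfl, h2⟩ :=
    exists_eq_two_pow_mul k a b c d (by linarith) (by linarith)
  have hx : x = a' + b' * zeta + c' * zeta ^ 2 + d' * zeta ^ 3 := by
    refine mul_left_cancel₀ (pow_ne_zero k (two_ne_zero (α := ℂ))) ?_
    rw [h]
    push_cast
    ring
  rw [hx]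
  exact exists_eq_zeta_pow_of_sum_sq_eq_one h2

/-! ### Clifford operators -/

/-- The unitary operator `U` has entries in `ℤ[ζ₈, 1/2]` and acts on the Pauli operators by the
symplectic map `f`. -/
structure IsClifford {n : ℕ} (U : Op n) (f : PhaseSpace n → PhaseSpace n) : Prop where
  mem_unitaryGroup : U ∈ Matrix.unitaryGroup (Fin n → ZMod 2) ℂ
  entry_mem : ∀ a b, U a b ∈ dyadicCyclotomic
  isSymp : IsSymp f
  acts : Acts U f

theorem isClifford_one {n : ℕ} : IsClifford (1 : Op n) id where
  mem_unitaryGroup := one_mem _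
  entry_mem a b := by
    rw [Matrix.one_apply]
    split_ifs
    exacts [one_mem _, zero_mem _]
  isSymp _ _ := rfl
  acts := acts_one

theorem IsClifford.mul {n : ℕ} {U V : Op n} {f g : PhaseSpace n → PhaseSpace n}
    (hU : IsClifford U f) (hV : IsClifford V g) : IsClifford (U * V) (f ∘ g) where
  mem_unitaryGroup := mul_mem hU.mem_unitaryGroup hV.mem_unitaryGroup
  entry_mem a b := by
    rw [Matrix.mul_apply]
    exact sum_mem fun c _ => mul_mem (hU.entry_mem a c) (hV.entry_mem c b)
  isSymp := hU.isSymp.comp hV.isSymp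
  acts := hU.acts.mul hV.acts

theorem IsClifford.exists_star {n : ℕ} {U : Op n} {f : PhaseSpace n → PhaseSpace n}
    (hU : IsClifford U f) :
    ∃ g, IsClifford (star U) g ∧ (∀ p, f (g p) = p) ∧ ∀ p, g (f p) = p := by
  obtain ⟨g, hg, hfg⟩ := hU.isSymp.exists_rightInverse
  refine ⟨g, ⟨Unitary.star_mem hU.mem_unitaryGroup,
    fun a b => star_mem_dyadicCyclotomic (hU.entry_mem b a), hg,
    hU.acts.inv (Matrix.mem_unitaryGroup_iff.1 hU.mem_unitaryGroup)
      (Matrix.mem_unitaryGroup_iff'.1 hU.mem_unitaryGroup) hfg⟩, hfg,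
    fun p => hU.isSymp.injective (hfg _)⟩

theorem qubitOp_mem_dyadicCyclotomic {p q r t : ℂ} (hp : p ∈ dyadicCyclotomic)
    (hq : q ∈ dyadicCyclotomic) (hr : r ∈ dyadicCyclotomic) (ht : t ∈ dyadicCyclotomic)
    (a b : ZMod 2) : qubitOp p q r t a b ∈ dyadicCyclotomic := by
  simp only [qubitOp, Matrix.of_apply]
  split_ifs <;> assumption

theorem onQubits_mem_dyadicCyclotomic {n : ℕ} {U : Matrix (ZMod 2) (ZMod 2) ℂ}
    (hU : ∀ a b, U a b ∈ dyadicCyclotomic) (v a b : Fin n → ZMod 2) :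
    onQubits U v a b ∈ dyadicCyclotomic := by
  rw [onQubits, tensor, Matrix.of_apply]
  refine prod_mem fun i _ => ?_
  split_ifs
  · exact hU _ _
  · rw [Matrix.one_apply]
    split_ifs
    exacts [one_mem _, zero_mem _]

theorem isClifford_hadamard {n : ℕ} (w : Fin n → ZMod 2) :
    IsClifford (onQubits hadamard w) (hAct w) where
  mem_unitaryGroup := onQubits_mem_unitaryGroup hadamard_mul_conjTranspose w
  entry_mem := onQubits_mem_dyadicCyclotomic (fun a b => by
    have h := inv_sqrt_two_mem_dyadicCyclotomic
    exact mul_mem h (qubitOp_mem_dyadicCyclotomic (one_mem _) (one_mem _) (one_mem _)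
      (neg_mem (one_mem _)) a b)) w
  isSymp := isSymp_hAct w
  acts := acts_hadamard w

theorem isClifford_phase {n : ℕ} (b : Fin n → ZMod 2) :
    IsClifford (onQubits phase b) (shear (Matrix.diagonal b)) where
  mem_unitaryGroup := onQubits_mem_unitaryGroup phase_mul_conjTranspose b
  entry_mem := onQubits_mem_dyadicCyclotomic
    (qubitOp_mem_dyadicCyclotomic (one_mem _) (zero_mem _) (zero_mem _) I_mem_dyadicCyclotomic) b
  isSymp := isSymp_shear (Matrix.isSymm_diagonal b)
  acts := acts_phase b

theorem isClifford_cnotLayer {n : ℕ} (A : GL (Fin n) (ZMod 2)) :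
    IsClifford (cnotLayer A) (xAct A) where
  mem_unitaryGroup := by
    have hinv : ∀ (A B : GL (Fin n) (ZMod 2)) (a b : Fin n → ZMod 2), A * B = 1 →
        b = A.val *ᵥ a → a = B.val *ᵥ b := by
      rintro A B a _ h rfl
      rw [Matrix.mulVec_mulVec, ← Units.val_mul, mul_eq_one_comm.1 h]
      simp
    have hstar : star (cnotLayer A) = cnotLayer A⁻¹ := by
      ext a b
      rw [Matrix.star_apply, cnotLayer, cnotLayer, Matrix.of_apply, Matrix.of_apply,
        if_congr ⟨hinv A A⁻¹ a b (mul_inv_cancel A), hinv A⁻¹ A b a (inv_mul_cancel A)⟩ rfl rfl]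
      split_ifs <;> simp
    rw [Matrix.mem_unitaryGroup_iff, hstar, cnotLayer_mul, mul_inv_cancel]
    ext a b
    simp [cnotLayer, Matrix.one_apply]
  entry_mem a b := by
    rw [cnotLayer, Matrix.of_apply]
    split_ifs
    exacts [one_mem _, zero_mem _]
  isSymp := isSymp_xAct A
  acts := acts_cnotLayer A

theorem isClifford_czLayer {n : ℕ} (B : SymmZeroDiag n) :
    IsClifford (czLayer B) (shear B.val) where
  mem_unitaryGroup := by
    have hsgn : ∀ t, sgn t * star (sgn t) = 1 := fun t => by
      rcases zmod_two_eq_zero_or_one t with rfl | rfl <;> simp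
    rw [Matrix.mem_unitaryGroup_iff, czLayer_eq_diagonal, Matrix.star_eq_conjTranspose,
      Matrix.diagonal_conjTranspose, Matrix.diagonal_mul_diagonal]
    simp only [Pi.star_apply, hsgn, Matrix.diagonal_one]
  entry_mem a b := by
    rw [czLayer_eq_diagonal, Matrix.diagonal_apply]
    split_ifs
    exacts [pow_mem (neg_mem (one_mem _)) _, zero_mem _]
  isSymp := isSymp_shear B.2.1
  acts := acts_czLayer B

theorem exists_isClifford_of_mem_stabilizerGroup {n : ℕ}
    {C : Matrix.unitaryGroup (Fin n → ZMod 2) ℂ} (hC : C ∈ stabilizerGroup n) :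
    ∃ f, IsClifford C.val f := by
  induction hC using Subgroup.closure_induction with
  | mem U hU =>
    rcases hU with ⟨i, h⟩ | ⟨i, h⟩ | ⟨i, j, hij, h⟩
    · refine ⟨shear (Matrix.diagonal (Pi.single i 1)), ?_⟩
      rw [h]
      exact isClifford_phase _
    · refine ⟨hAct (Pi.single i 1), ?_⟩
      rw [h]
      exact isClifford_hadamard _
    · obtain ⟨A, hA⟩ := cnotGate_eq_cnotLayer hij
      exact ⟨_, h ▸ hA ▸ isClifford_cnotLayer A⟩
  | one => exact ⟨id, isClifford_one⟩
  | mul U V _ _ hU hV =>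
    obtain ⟨f, hf⟩ := hU
    obtain ⟨g, hg⟩ := hV
    exact ⟨f ∘ g, hf.mul hg⟩
  | inv U _ hU =>
    obtain ⟨f, hf⟩ := hU
    obtain ⟨g, hg, -⟩ := hf.exists_star
    exact ⟨g, hg⟩

/-- A Clifford operator commuting with all Pauli operators up to scalars is a Pauli operator up
to an eighth root of unity. -/
theorem IsClifford.eq_zeta_pow_smul_pauli {n : ℕ} {U : Op n} (hU : IsClifford U id) :
    ∃ (k : ℕ) (q : PhaseSpace n), U = zeta ^ k • pauli q := by
  obtain ⟨c, q, rfl⟩ := hU.acts.eq_smul_pauli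
  have hc : c ∈ dyadicCyclotomic := by
    have := hU.entry_mem q.1 0
    rwa [Matrix.smul_apply, pauli_apply, zero_add, if_pos rfl, dotProduct_zero, sgn_zero,
      smul_eq_mul, mul_one] at this
  -- The column of `c • pauli q` with index `0` has the single nonzero entry `c`.
  have h1 : star c * c = 1 := by
    have := congrFun₂ (Matrix.mem_unitaryGroup_iff'.1 hU.mem_unitaryGroup) 0 0
    rw [Matrix.mul_apply, Finset.sum_eq_single q.1] at this
    · simpa [pauli_apply] using this
    · intro a _ ha
      simp [pauli_apply, ha]
    · simp
  obtain ⟨k, rfl⟩ := exists_eq_zeta_pow hc h1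
  exact ⟨k, q, rfl⟩

theorem two_mul_card_czPairs_reduced_le {n : ℕ} (s : Fin (n / 2) → ZMod 2) :
    2 * (czPairs (reduced s)).card ≤ n := by
  have hp : ∀ p ∈ czPairs (reduced s), p.1.val < n / 2 ∧ p.2.val = p.1.val + n / 2 := by
    intro p hp
    simp only [czPairs, Finset.mem_filter, Finset.mem_univ, true_and, reduced, reducedEntries,
      Matrix.of_apply, Fin.lt_def] at hp
    obtain ⟨hlt, h⟩ := hp
    split_ifs at h with h1 h2
    · exact h1
    · omega
    · exact absurd h (by decide)
  have hcard : (czPairs (reduced s)).card ≤ (Finset.range (n / 2)).card := by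
    refine Finset.card_le_card_of_injOn (fun p => p.1.val)
      (fun p h => Finset.mem_coe.2 (Finset.mem_range.2 (hp p h).1)) fun p h q h' hpq => ?_
    have h1 : p.1 = q.1 := Fin.ext hpq
    exact Prod.ext h1 (Fin.ext (by rw [(hp p h).2, (hp q h').2, h1]))
  rw [Finset.card_range] at hcard
  omega

end StabilizerCircuit

end

open StabilizerCircuit
theorem mainTheorem2 (n : ℕ) (C : Matrix.unitaryGroup (Fin n → ZMod 2) ℂ)
    (hC : C ∈ stabilizerGroup n) :
    ∃ (b d u v w : Fin n → ZMod 2) (s s' : Fin (n / 2) → ZMod 2)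
      (A₁ A₂ A₃ : GL (Fin n) (ZMod 2)) (φ : ℝ),
      (∃ k : ℤ, φ = k * (Real.pi / 4)) ∧
      (C : Op n) =
        onQubits hadamard w * onQubits phase b * cnotLayer A₁ * czLayer (reduced s) *
          onQubits hadamard (fun _ => 1) *
          (Complex.exp (Complex.I * φ) • (onQubits pauliX u * onQubits pauliZ v)) *
          cnotLayer A₂ * czLayer (reduced s') * cnotLayer A₃ * onQubits phase d ∧
      2 * (czPairs (reduced s)).card ≤ n ∧ 2 * (czPairs (reduced s')).card ≤ n := by
  obtain ⟨f, hf⟩ := exists_isClifford_of_mem_stabilizerGroup hC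
  obtain ⟨w, b, d, s, s', A₁, A₂, A₃, hnf⟩ := hf.isSymp.exists_normalForm
  have hL := (((isClifford_hadamard w).mul (isClifford_phase b)).mul (isClifford_cnotLayer A₁)).mul
    (isClifford_czLayer (reduced s)) |>.mul (isClifford_hadamard 1)
  have hR := (((isClifford_cnotLayer A₂).mul (isClifford_czLayer (reduced s'))).mul
    (isClifford_cnotLayer A₃)).mul (isClifford_phase d)
  obtain ⟨gL, hgL, -, hL'⟩ := hL.exists_star
  obtain ⟨gR, hgR, hR', -⟩ := hR.exists_star
  have hid : gL ∘ f ∘ gR = id := funext fun p => by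
    simp only [Function.comp_apply, id] at hL' hR' ⊢
    rw [hnf, hR', hL']
  obtain ⟨k, q, hq⟩ := (hid ▸ hgL.mul (hf.mul hgR)).eq_zeta_pow_smul_pauli
  refine ⟨b, d, q.1, q.2, w, s, s', A₁, A₂, A₃, k * (Real.pi / 4), ⟨k, by push_cast; rfl⟩, ?_,
    two_mul_card_czPairs_reduced_le s, two_mul_card_czPairs_reduced_le s'⟩
  rw [← zeta_pow]
  change _ = onQubits hadamard w * onQubits phase b * cnotLayer A₁ * czLayer (reduced s) *
    onQubits hadamard 1 * (zeta ^ k • pauli q) * cnotLayer A₂ * czLayer (reduced s') *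
    cnotLayer A₃ * onQubits phase d
  have hL1 := Matrix.mem_unitaryGroup_iff.1 hL.mem_unitaryGroup
  have hR1 := Matrix.mem_unitaryGroup_iff'.1 hR.mem_unitaryGroup
  set L := onQubits hadamard w * onQubits phase b * cnotLayer A₁ * czLayer (reduced s) *
    onQubits hadamard 1
  have hassoc : L * (zeta ^ k • pauli q) * cnotLayer A₂ * czLayer (reduced s') *
      cnotLayer A₃ * onQubits phase d = L * (zeta ^ k • pauli q) *
        (cnotLayer A₂ * czLayer (reduced s') * cnotLayer A₃ * onQubits phase d) := by
    simp only [mul_assoc]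
  rw [hassoc, ← hq]
  set R := cnotLayer A₂ * czLayer (reduced s') * cnotLayer A₃ * onQubits phase d
  calc (C : Op n) = (L * star L) * C * (star R * R) := by rw [hL1, hR1, one_mul, mul_one]
    _ = L * (star L * (C * star R)) * R := by simp only [mul_assoc]
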